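/- Let $p\in(0,1)$ and let $\{\omega_v\}_{v\in\mathbb Z_+^2}$ be i.i.d. Bernoulli($p$) weights. For $m,n\in\mathbb Z_+$ let $$G_{m,n}=\max_{\pi}\ \sum_{i=0}^{m+n-1}\omega_{v_{i+1}}\mathbf 1\{v_{i+1}-v_i=e_1\},$$ where the maximum is over all lattice paths $\pi=(v_0,\dots,v_{m+n})$ with $v_0=(0,0)$, $v_{m+n}=(m,n)$ and steps $v_{i+1}-v_i\in\{e_1,e_2\}$, $e_1=(1,0)$, $e_2=(0,1)$. The right-tail rate function $J_{s,t}(r)$ is defined as follows. For $s,t>0$ and $r<s$, $$J_{s,t}(r)=-\lim_{N\to\infty}N^{-1}\log\mathbb P\{G_{\lfloor Ns\rfloor,\lfloor Nt\rfloor}\ge Nr\};$$ at the remaining points of $\{(s,t,r): s\ge 0,\ t\ge 0,\ r\le s\}$ it is the lower semicontinuous extension, i.e. the lower limit of $J_{s',t'}(r')$ as $(s',t',r')\to(s,t,r)$ with $s',t'>0$, $r'<s'$; and $J_{s,t}(r)=+\infty$ at all other $(s,t,r)$. Let $J^*_{s,t}(\xi)=\sup_{r\in\mathbb R}\{r\xi-J_{s,t}(r)\}$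 be its Legendre dual. **Theorem.** The limit defining $J_{s,t}(r)$ exists for all $s,t>0$ and $r<s$. For $s,t\ge 0$ and $\xi\ge 0$ put $$\Delta=p(1-p)(e^\xi+e^{-\xi}-2)\big[p(1-p)(s+t)^2(e^\xi+e^{-\xi}-2)+4st\big].$$ Then: * if $t<\frac{1-p}{p}s$ and $\xi>0$, $$J^*_{s,t}(\xi)=s\log\frac{p(1-p)(s+t)(e^\xi+e^{-\xi}-2)+2s+\sqrt\Delta}{2s\,(1-p(1-e^{-\xi}))}+t\log\frac{\big[p(1-p)(s+t)(e^\xi+e^{-\xi}-2)+\sqrt\Delta\big](1-p(1-e^{-\xi}))}{p(1-p)(t-s)(e^\xi+e^{-\xi}-2)+\sqrt\Delta},$$ where for $t=0$ the second summand is read as $0$; * if $t\ge\frac{1-p}{p}s$ (the flat edge), $J^*_{s,t}(\xi)=s\xi$ for every $\xi\ge 0$; * $J^*_{s,t}(0)=0$ in all cases. -/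

import Mathlib

open Filter Topology MeasureTheory ProbabilityTheory

namespace BernoulliLPP

/-- The environment: weights indexed by the lattice points of the quadrant, which are independent and
Bernoulli with success probability `p` under `μ`. -/
structure IsBernoulliEnv {Ω : Type*} [MeasurableSpace Ω] (μ : Measure Ω) (p : ℝ)
    (ω : ℕ × ℕ → Ω → ℕ) : Prop where
  measurable : ∀ v, Measurable (ω v)
  indep : iIndepFun ω μ
  prob_one : ∀ v, μ {x | ω v x = 1} = ENNReal.ofReal p
  prob_zero : ∀ v, μ {x | ω v x = 0} = ENNReal.ofReal (1 - p)

/-- `v 0, …, v (m + n)` is an admissible (up-right) lattice path from `(0, 0)` to `(m, n)`.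
The values `v i` with `m + n < i` play no role. -/
structure IsPath (m n : ℕ) (v : ℕ → ℕ × ℕ) : Prop where
  start : v 0 = (0, 0)
  finish : v (m + n) = (m, n)
  step : ∀ i < m + n, v (i + 1) = v i + (1, 0) ∨ v (i + 1) = v i + (0, 1)

/-- The potential collected by a step `z` leaving the site `v`: a step `e₁ = (1, 0)` collects the weight
at its target site `v + e₁`, a step `e₂ = (0, 1)` collects nothing. -/
def potential (w : ℕ × ℕ → ℕ) (v z : ℕ × ℕ) : ℕ :=
  if z = (1, 0) then w (v + (1, 0)) else 0

/-- The total weight that the path `v 0, …, v k` collects; coordinatewise subtraction `v (i + 1) - v i`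
is the `i`-th step of an admissible path. -/
def pathWeight (w : ℕ × ℕ → ℕ) (k : ℕ) (v : ℕ → ℕ × ℕ) : ℕ :=
  ∑ i ∈ Finset.range k, potential w (v i) (v (i + 1) - v i)

/-- The last passage time `G_{m,n}` from `(0, 0)` to `(m, n)` in the environment `w`: the maximal
weight of an admissible path (a supremum over a finite non-empty set of natural numbers). -/
noncomputable def lastPassage (w : ℕ × ℕ → ℕ) (m n : ℕ) : ℕ :=
  sSup {k | ∃ v, IsPath m n v ∧ k = pathWeight w (m + n) v}

/-- `-N⁻¹ log P(G_{⌊Ns⌋,⌊Nt⌋} ≥ N r)`, as an extended real number (with `log 0 = -∞`). -/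
noncomputable def tailExponent {Ω : Type*} [MeasurableSpace Ω] (μ : Measure Ω)
    (ω : ℕ × ℕ → Ω → ℕ) (s t r : ℝ) (N : ℕ) : EReal :=
  -(ENNReal.log (μ {x | (N : ℝ) * r ≤
      (lastPassage (fun v => ω v x) ⌊(N : ℝ) * s⌋₊ ⌊(N : ℝ) * t⌋₊ : ℝ)}) / ((N : ℝ) : EReal))

/-- The interior of the set of triples `(s, t, r)` on which the rate function is finite. -/
def rateInterior : Set (ℝ × ℝ × ℝ) := {y | 0 < y.1 ∧ 0 < y.2.1 ∧ y.2.2 < y.1}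

/-- The right-tail exponent on the interior of the domain, where the upper limit is a limit. -/
noncomputable def rateLimit {Ω : Type*} [MeasurableSpace Ω] (μ : Measure Ω)
    (ω : ℕ × ℕ → Ω → ℕ) (y : ℝ × ℝ × ℝ) : EReal :=
  limsup (tailExponent μ ω y.1 y.2.1 y.2.2) atTop

open Classical in
/-- The right-tail rate function `J_{s,t}(r)`: the limiting exponent in the interior of the domain, its
lower semicontinuous extension from the interior to the boundary of the domain, and `+∞` outside the
closure of the domain. -/
noncomputable def rateJ {Ω : Type*} [MeasurableSpace Ω] (μ : Measure Ω)
    (ω : ℕ × ℕ → Ω → ℕ) (s t r : ℝ) : EReal :=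
  if (s, t, r) ∈ rateInterior then rateLimit μ ω (s, t, r)
  else if 0 ≤ s ∧ 0 ≤ t ∧ r ≤ s then liminf (rateLimit μ ω) (𝓝[rateInterior] (s, t, r))
  else ⊤

/-- The Legendre (convex) dual `f*(y) = sup_x (x y - f x)`. -/
noncomputable def legendreDual (f : ℝ → EReal) (y : ℝ) : EReal :=
  ⨆ x : ℝ, (((x * y : ℝ) : EReal) - f x)

/-- The discriminant `Δ`. -/
noncomputable def discr (p s t ξ : ℝ) : ℝ :=
  p * (1 - p) * (Real.exp ξ + Real.exp (-ξ) - 2) *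
    (p * (1 - p) * (s + t) ^ 2 * (Real.exp ξ + Real.exp (-ξ) - 2) + 4 * s * t)

end BernoulliLPP

/-!
The model with boundaries. Put independent Bernoulli(`u`) increments of the passage time along the
south boundary and independent geometric increments along the west boundary, with `p < u < 1` and
the geometric parameter `p (1 - u) / (u (1 - p))`. A cell update turns a pair of independent
increments with these laws into another such pair (`isBurke_bern_geom`), and summing this over the
cells, a row at a time, shows that the horizontal increments stay independent Bernoulli(`u`) at every
height (`lintegral_prod_rInc`). Hence the exponential moment of
`(passage time with boundaries) - (sum of the west increments)` is known exactly: it is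
`exp (m L(u))`, where `L = hLog ξ` is the logarithmic moment generating function of Bernoulli(`u`).
Let `g = vLog p ξ` be minus that of the geometric law at `-ξ`.

On the one hand the boundaries only increase the passage time, and the bulk is independent of the
boundary, so `log E exp (ξ G_{m,n}) ≤ m L(u) + (n + 1) g(u)` for every `u` (`logMoment_le`). On the
other hand the maximizing path leaves the boundary somewhere, so that for every `u` this inequality is
an equality, up to `log (m + n + 2)`, at some endpoint on the top or right side of the rectangle
(`exists_le_logMoment`). If `u` is a critical point of `s L + t g` and `(m, n) ≈ N (s, t)`, then that
endpoint has to be close to the corner `(m, n)`: at any other endpoint of the two sides a parameter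
slightly above or below `u` would contradict the upper bound. So `N⁻¹ log E exp (ξ G)` tends to
`s L(u) + t g(u)` in the direction `(s, t)` (`eventually_le_logMoment_of_critical`). The critical
equation is a quadratic equation with discriminant `Δ` (`exists_critical_param`), whose solution lies
below `1` exactly for `t < (1 - p) / p * s`; on the flat edge the value `s ξ` is reached as `u → 1`.

The tail probabilities are supermultiplicative in `N`, because consecutive blocks use disjoint columns,
so their exponents converge by Fekete's lemma. Markov's inequality bounds the Legendre dual by the
limit of `N⁻¹ log E exp (ξ G)`, also on the boundary of the domain, where the rate function is a lower
limit (`IsBernoulliEnv.legendreDual_le`). Conversely, sorting the values of `G` into finitely many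
bins produces tail exponents that account for the exponential moment
(`IsBernoulliEnv.exists_rateLimit_le`); when `s = 0` or `t = 0`, a limit point of almost maximizers at
nearby interior points does the same.
-/

namespace BernoulliLPP

/-! ### The last passage recursion -/

/-- The last passage time through columns `1, …, m` and rows `0, …, n - 1`, as defined by the
recursion that decides whether the maximizing path enters its last site from below or from the left.
Indexing by the number `n` of rows makes the empty strip `n = 0` available as an initial value. -/
def lpp (w : ℕ × ℕ → ℕ) : ℕ → ℕ → ℕ
  | 0, _ => 0
  | _ + 1, 0 => 0
  | m + 1, n + 1 => max (lpp w (m + 1) n) (lpp w m (n + 1) + w (m + 1, n))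

/-- The environment seen from the lattice point `c`. -/
def shiftEnv (c : ℕ × ℕ) (w : ℕ × ℕ → ℕ) : ℕ × ℕ → ℕ := fun v => w (c + v)

@[simp] lemma lpp_zero_left (w : ℕ × ℕ → ℕ) (n : ℕ) : lpp w 0 n = 0 := by
  rw [lpp]

@[simp] lemma lpp_zero_right (w : ℕ × ℕ → ℕ) (m : ℕ) : lpp w m 0 = 0 := by
  cases m <;> rw [lpp]

lemma lpp_succ_succ (w : ℕ × ℕ → ℕ) (m n : ℕ) :
    lpp w (m + 1) (n + 1) = max (lpp w (m + 1) n) (lpp w m (n + 1) + w (m + 1, n)) := by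
  rw [lpp]

lemma lpp_le_succ_right (w : ℕ × ℕ → ℕ) (m n : ℕ) : lpp w m n ≤ lpp w m (n + 1) := by
  cases m with
  | zero => simp
  | succ m => rw [lpp_succ_succ]; exact le_max_left _ _

lemma lpp_add_le (w : ℕ × ℕ → ℕ) (m n : ℕ) :
    lpp w m (n + 1) + w (m + 1, n) ≤ lpp w (m + 1) (n + 1) := by
  rw [lpp_succ_succ]; exact le_max_right _ _

lemma lpp_le_succ_left (w : ℕ × ℕ → ℕ) (m n : ℕ) : lpp w m n ≤ lpp w (m + 1) n := by
  cases n with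
  | zero => simp
  | succ n => exact (Nat.le_add_right _ _).trans (lpp_add_le w m n)

lemma lpp_mono (w : ℕ × ℕ → ℕ) {m m' n n' : ℕ} (hm : m ≤ m') (hn : n ≤ n') :
    lpp w m n ≤ lpp w m' n' :=
  (monotone_nat_of_le_succ (f := fun k => lpp w k n) (fun k => lpp_le_succ_left w k n) hm).trans
    (monotone_nat_of_le_succ (f := fun k => lpp w m' k) (fun k => lpp_le_succ_right w m' k) hn)

lemma lpp_congr {w w' : ℕ × ℕ → ℕ} (m n : ℕ)
    (h : ∀ i j, 1 ≤ i → i ≤ m → j < n → w (i, j) = w' (i, j)) : lpp w m n = lpp w' m n := by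
  induction m generalizing n with
  | zero => simp
  | succ m ihm =>
    induction n with
    | zero => simp
    | succ n ihn =>
      rw [lpp_succ_succ, lpp_succ_succ,
        ihn fun i j h1 h2 h3 => h i j h1 h2 (by omega),
        ihm (n + 1) fun i j h1 h2 h3 => h i j h1 (by omega) h3,
        h (m + 1) n (by omega) le_rfl (by omega)]

lemma lpp_le_of_weights_le_one {w : ℕ × ℕ → ℕ} (hw : ∀ v, w v ≤ 1) (m n : ℕ) : lpp w m n ≤ m := by
  induction m generalizing n with
  | zero => simp
  | succ m ihm =>
    induction n with
    | zero => simp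
    | succ n ihn =>
      rw [lpp_succ_succ]
      exact max_le ihn (add_le_add (ihm _) (hw _))

/-- Concatenating a path to `(m, n)` with a path that starts there. -/
lemma lpp_add_shift_le (w : ℕ × ℕ → ℕ) (m n m' n' : ℕ) :
    lpp w m (n + 1) + lpp (shiftEnv (m, n) w) m' (n' + 1) ≤ lpp w (m + m') (n + n' + 1) := by
  induction m' generalizing n' with
  | zero => simpa using lpp_mono w le_rfl (by omega)
  | succ m' ihm =>
    have key : ∀ n', lpp w m (n + 1) + (lpp (shiftEnv (m, n) w) m' (n' + 1) +
        shiftEnv (m, n) w (m' + 1, n')) ≤ lpp w (m + (m' + 1)) (n + n' + 1) := by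
      intro n'
      refine le_trans ?_ (lpp_add_le w (m + m') (n + n'))
      have h := ihm n'
      have h2 : shiftEnv (m, n) w (m' + 1, n') = w (m + m' + 1, n + n') := rfl
      omega
    induction n' with
    | zero =>
      rw [lpp_succ_succ, lpp_zero_right, max_eq_right (Nat.zero_le _)]
      exact key 0
    | succ n' ihn =>
      rw [lpp_succ_succ]
      rcases max_choice (lpp (shiftEnv (m, n) w) (m' + 1) (n' + 1))
        (lpp (shiftEnv (m, n) w) m' (n' + 1 + 1) + shiftEnv (m, n) w (m' + 1, n' + 1)) with h | h
      · rw [h]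
        exact ihn.trans (lpp_le_succ_right _ _ _)
      · rw [h]
        exact key (n' + 1)

lemma pathWeight_le_lpp (w : ℕ × ℕ → ℕ) {m n : ℕ} {v : ℕ → ℕ × ℕ} (hv : IsPath m n v) (k : ℕ)
    (hk : k ≤ m + n) : pathWeight w k v ≤ lpp w (v k).1 ((v k).2 + 1) := by
  induction k with
  | zero => simp [pathWeight]
  | succ k ih =>
    have ih := ih (by omega)
    have hsum : pathWeight w (k + 1) v
        = pathWeight w k v + potential w (v k) (v (k + 1) - v k) := by
      simp [pathWeight, Finset.sum_range_succ]
    rcases hv.step k (by omega) with h | h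
    · have hd : v (k + 1) - v k = (1, 0) := by rw [h]; ext <;> simp
      rw [hsum, hd, potential, if_pos rfl, h]
      exact (Nat.add_le_add_right ih _).trans (lpp_add_le w (v k).1 (v k).2)
    · have hd : v (k + 1) - v k = (0, 1) := by rw [h]; ext <;> simp
      rw [hsum, hd, potential, if_neg (by simp), h]
      exact ih.trans (lpp_le_succ_right w _ _)

lemma IsPath.extend {m n m' n' : ℕ} {v : ℕ → ℕ × ℕ} (hv : IsPath m n v) {e : ℕ × ℕ}
    (he : e = (1, 0) ∨ e = (0, 1)) (hmn : (m', n') = (m, n) + e) (w : ℕ × ℕ → ℕ) :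
    ∃ v', IsPath m' n' v' ∧
      pathWeight w (m' + n') v' = pathWeight w (m + n) v + potential w (m, n) e := by
  have hk : m' + n' = m + n + 1 := by
    simp only [Prod.ext_iff, Prod.fst_add, Prod.snd_add] at hmn
    rcases he with rfl | rfl <;> simp_all <;> omega
  refine ⟨fun i => if i ≤ m + n then v i else (m', n'), ⟨?_, ?_, ?_⟩, ?_⟩
  · simp [hv.start]
  · simp [hk]
  · intro i hi
    rcases Nat.lt_or_ge i (m + n) with h | h
    · simpa [h.le, Nat.succ_le_of_lt h] using hv.step i h
    · have : i = m + n := by omega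
      subst this
      rcases he with rfl | rfl <;> simp [hv.finish, hmn]
  · rw [hk]
    simp only [pathWeight]
    rw [Finset.sum_range_succ]
    congr 1
    · refine Finset.sum_congr rfl fun i hi => ?_
      have hi := Finset.mem_range.1 hi
      simp [hi.le, Nat.succ_le_of_lt hi]
    · simp [hv.finish, hmn]

lemma exists_path_lpp_le (w : ℕ × ℕ → ℕ) (m n : ℕ) :
    ∃ v, IsPath m n v ∧ lpp w m (n + 1) ≤ pathWeight w (m + n) v := by
  induction m generalizing n with
  | zero =>
    induction n with
    | zero => exact ⟨fun _ => (0, 0), ⟨rfl, rfl, by simp⟩, by simp⟩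
    | succ n ih =>
      obtain ⟨v, hv, -⟩ := ih
      obtain ⟨v', hv', -⟩ := hv.extend (m' := 0) (n' := n + 1) (Or.inr rfl) (by simp) w
      exact ⟨v', hv', by simp⟩
  | succ m ihm =>
    have key : ∀ n, ∃ v, IsPath (m + 1) n v ∧
        lpp w m (n + 1) + w (m + 1, n) ≤ pathWeight w (m + 1 + n) v := by
      intro n
      obtain ⟨v, hv, h⟩ := ihm n
      obtain ⟨v', hv', h'⟩ := hv.extend (m' := m + 1) (n' := n) (Or.inl rfl) (by simp) w
      refine ⟨v', hv', ?_⟩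
      rw [h']
      simpa [potential] using h
    induction n with
    | zero =>
      obtain ⟨v, hv, h⟩ := key 0
      exact ⟨v, hv, by rw [lpp_succ_succ]; simpa using h⟩
    | succ n ihn =>
      rw [lpp_succ_succ]
      rcases max_choice (lpp w (m + 1) (n + 1)) (lpp w m (n + 1 + 1) + w (m + 1, n + 1)) with h | h
      · obtain ⟨v, hv, h1⟩ := ihn
        obtain ⟨v', hv', h'⟩ := hv.extend (m' := m + 1) (n' := n + 1) (Or.inr rfl) (by simp) w
        exact ⟨v', hv', by rw [h, h']; omega⟩
      · rw [h]
        exact key (n + 1)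

/-- The maximum over paths satisfies the last passage recursion. -/
lemma lastPassage_eq_lpp (w : ℕ × ℕ → ℕ) (m n : ℕ) : lastPassage w m n = lpp w m (n + 1) := by
  have hbound : ∀ k ∈ {k | ∃ v, IsPath m n v ∧ k = pathWeight w (m + n) v},
      k ≤ lpp w m (n + 1) := by
    rintro k ⟨v, hv, rfl⟩
    simpa [hv.finish] using pathWeight_le_lpp w hv (m + n) le_rfl
  obtain ⟨v, hv, h⟩ := exists_path_lpp_le w m n
  exact le_antisymm (csSup_le ⟨_, v, hv, rfl⟩ hbound)
    (h.trans (le_csSup ⟨_, hbound⟩ ⟨v, hv, rfl⟩))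

/-! ### Last passage with boundary values -/

/-- The update of a horizontal increment `a` and a vertical increment `b` across a site of weight
`k`: the horizontal increment on the opposite side of the cell. -/
def stepI (a b k : ℕ) : ℕ := max (a - b) k

/-- The vertical increment on the opposite side of the cell; truncated subtraction is the positive
part. -/
def stepJ (a b k : ℕ) : ℕ := b + k - a

/-- The vertical increments along a row, given the horizontal increments `a` below it, the
increment `b` on its left, and its weights `r`. -/
def queue (a : ℕ → ℕ) (b : ℕ) (r : ℕ → ℕ) : ℕ → ℕ
  | 0 => b
  | i + 1 => stepJ (a i) (queue a b r i) (r i)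

/-- The horizontal increments of the last passage time with boundary: `rowInc a b w j i` is the
increment between columns `i` and `i + 1` at height `j`, where height `0` is the south boundary with
increments `a`, the west boundary has increments `b`, and the row of weights with second index `j`
lies between heights `j` and `j + 1`. -/
def rowInc (a b : ℕ → ℕ) (w : ℕ × ℕ → ℕ) : ℕ → ℕ → ℕ
  | 0 => a
  | j + 1 => fun i => stepI (rowInc a b w j i)
      (queue (rowInc a b w j) (b j) (fun i => w (i + 1, j)) i) (w (i + 1, j))

/-- The vertical increment between heights `j` and `j + 1` in column `i`. -/
def colInc (a b : ℕ → ℕ) (w : ℕ × ℕ → ℕ) (j i : ℕ) : ℕ :=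
  queue (rowInc a b w j) (b j) (fun i => w (i + 1, j)) i

/-- The last passage time with boundary increments `a` (south) and `b` (west). -/
def blpp (a b : ℕ → ℕ) (w : ℕ × ℕ → ℕ) (m n : ℕ) : ℕ :=
  ∑ j ∈ Finset.range n, b j + ∑ i ∈ Finset.range m, rowInc a b w n i

lemma rowInc_succ (a b : ℕ → ℕ) (w : ℕ × ℕ → ℕ) (j i : ℕ) :
    rowInc a b w (j + 1) i = stepI (rowInc a b w j i) (colInc a b w j i) (w (i + 1, j)) := rfl

lemma colInc_succ (a b : ℕ → ℕ) (w : ℕ × ℕ → ℕ) (j i : ℕ) :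
    colInc a b w j (i + 1) = stepJ (rowInc a b w j i) (colInc a b w j i) (w (i + 1, j)) := rfl

lemma colInc_zero (a b : ℕ → ℕ) (w : ℕ × ℕ → ℕ) (j : ℕ) : colInc a b w j 0 = b j := rfl

lemma stepI_add (a b k : ℕ) : b + stepI a b k = max a (b + k) := by
  simp only [stepI]; omega

lemma add_stepJ (a b k : ℕ) : a + stepJ a b k = max a (b + k) := by
  simp only [stepJ]; omega

lemma blpp_succ_right (a b : ℕ → ℕ) (w : ℕ × ℕ → ℕ) (m n : ℕ) :
    blpp a b w m (n + 1) = blpp a b w m n + colInc a b w n m := by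
  induction m with
  | zero => simp [blpp, Finset.sum_range_succ, colInc_zero]
  | succ m ih =>
    have h1 : ∀ n, blpp a b w (m + 1) n = blpp a b w m n + rowInc a b w n m := by
      intro n; simp only [blpp, Finset.sum_range_succ]; omega
    rw [h1, h1, ih, rowInc_succ, colInc_succ, add_assoc, add_assoc, stepI_add, add_stepJ]

lemma blpp_succ_succ (a b : ℕ → ℕ) (w : ℕ × ℕ → ℕ) (m n : ℕ) :
    blpp a b w (m + 1) (n + 1)
      = max (blpp a b w (m + 1) n) (blpp a b w m (n + 1) + w (m + 1, n)) := by
  have h1 : ∀ n, blpp a b w (m + 1) n = blpp a b w m n + rowInc a b w n m := by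
    intro n; simp only [blpp, Finset.sum_range_succ]; omega
  rw [h1, h1, blpp_succ_right, rowInc_succ, add_assoc, stepI_add]
  omega

lemma blpp_zero_right (a b : ℕ → ℕ) (w : ℕ × ℕ → ℕ) (m : ℕ) :
    blpp a b w m 0 = ∑ i ∈ Finset.range m, a i := by
  simp [blpp, rowInc]

lemma blpp_zero_left (a b : ℕ → ℕ) (w : ℕ × ℕ → ℕ) (n : ℕ) :
    blpp a b w 0 n = ∑ j ∈ Finset.range n, b j := by
  simp [blpp]

lemma lpp_le_blpp (a b : ℕ → ℕ) (w : ℕ × ℕ → ℕ) (m n : ℕ) : lpp w m n ≤ blpp a b w m n := by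
  induction m generalizing n with
  | zero => simp
  | succ m ihm =>
    induction n with
    | zero => simp
    | succ n ihn =>
      rw [lpp_succ_succ, blpp_succ_succ]
      exact max_le_max ihn (Nat.add_le_add_right (ihm _) _)

/-- A maximizing path follows the south boundary for `k` steps or the west boundary up to row `l`,
and then stays in the bulk. -/
lemma blpp_le_exit (a b : ℕ → ℕ) (w : ℕ × ℕ → ℕ) (m n : ℕ) :
    (∃ k ≤ m, blpp a b w m n
      ≤ ∑ i ∈ Finset.range k, a i + lpp (shiftEnv (k, 0) w) (m - k) n) ∨
    (∃ l < n, blpp a b w m n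
      ≤ ∑ j ∈ Finset.range (l + 1), b j + lpp (shiftEnv (0, l) w) m (n - l)) := by
  induction m generalizing n with
  | zero =>
    cases n with
    | zero => exact Or.inl ⟨0, le_rfl, by simp [blpp]⟩
    | succ n => exact Or.inr ⟨n, by omega, by simp [blpp_zero_left]⟩
  | succ m ihm =>
    induction n with
    | zero => exact Or.inl ⟨m + 1, le_rfl, by simp [blpp_zero_right]⟩
    | succ n ihn =>
      rw [blpp_succ_succ]
      rcases max_choice (blpp a b w (m + 1) n) (blpp a b w m (n + 1) + w (m + 1, n)) with h | h
      · rw [h]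
        rcases ihn with ⟨k, hk, h1⟩ | ⟨l, hl, h1⟩
        · refine Or.inl ⟨k, hk, h1.trans (Nat.add_le_add_left (lpp_le_succ_right _ _ _) _)⟩
        · refine Or.inr ⟨l, by omega, h1.trans (Nat.add_le_add_left (lpp_mono _ le_rfl ?_) _)⟩
          omega
      · rw [h]
        rcases ihm (n + 1) with ⟨k, hk, h1⟩ | ⟨l, hl, h1⟩
        · refine Or.inl ⟨k, by omega, (Nat.add_le_add_right h1 _).trans ?_⟩
          have h2 := lpp_add_le (shiftEnv (k, 0) w) (m - k) n
          have h3 : shiftEnv (k, 0) w (m - k + 1, n) = w (m + 1, n) := by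
            simp only [shiftEnv, Prod.mk_add_mk, zero_add]
            congr 2; omega
          rw [h3, show m - k + 1 = m + 1 - k by omega] at h2
          omega
        · refine Or.inr ⟨l, hl, (Nat.add_le_add_right h1 _).trans ?_⟩
          have h2 := lpp_add_le (shiftEnv (0, l) w) m (n - l)
          have h3 : shiftEnv (0, l) w (m + 1, n - l) = w (m + 1, n) := by
            simp only [shiftEnv, Prod.mk_add_mk, zero_add]
            congr 2; omega
          rw [h3, show n - l + 1 = n + 1 - l by omega] at h2
          omega

/-! ### Resampling coordinates of a product measure -/

open Function in
/-- Under a product measure, replacing one coordinate by an independent copy changes nothing. -/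
lemma lintegral_infinitePi_resample {ι : Type*} [DecidableEq ι] (ν : ι → Measure ℕ)
    [∀ i, IsProbabilityMeasure (ν i)] (s : ι) {H : (ι → ℕ) → ENNReal} (hH : Measurable H) :
    ∫⁻ w, H w ∂(Measure.infinitePi ν)
      = ∫⁻ w, ∫⁻ x, H (update w s x) ∂(ν s) ∂(Measure.infinitePi ν) := by
  have hmeas : Measurable (fun z : (ι → ℕ) × ℕ => update z.1 s z.2) := by
    refine measurable_pi_iff.2 fun i => ?_
    rcases eq_or_ne i s with rfl | h
    · simpa using measurable_snd
    · simp only [update_of_ne h]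
      exact (measurable_pi_apply i).comp measurable_fst
  have hlaw : ((Measure.infinitePi ν).prod (ν s)).map (fun z => update z.1 s z.2)
      = Measure.infinitePi ν := by
    refine Measure.eq_infinitePi ν fun S t ht => ?_
    rw [Measure.map_apply hmeas (MeasurableSet.pi S.countable_toSet fun i _ => ht i)]
    have hpre : (fun z : (ι → ℕ) × ℕ => update z.1 s z.2) ⁻¹' (Set.pi S t)
        = (Set.pi (S.erase s) t) ×ˢ (if s ∈ S then t s else Set.univ) := by
      ext z
      simp only [Set.mem_preimage, Set.mem_pi, Set.mem_prod, Finset.mem_coe, Finset.mem_erase]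
      constructor
      · intro h
        refine ⟨fun i hi => by simpa [hi.1] using h i hi.2, ?_⟩
        split_ifs with hs
        · simpa using h s hs
        · trivial
      · rintro ⟨h1, h2⟩ i hi
        rcases eq_or_ne i s with rfl | h
        · simpa [hi] using h2
        · simpa [h] using h1 i ⟨h, hi⟩
    rw [hpre, Measure.prod_prod, Measure.infinitePi_pi _ fun i _ => ht i]
    split_ifs with hs
    · rw [Finset.prod_erase_mul _ _ hs]
    · rw [measure_univ, mul_one, Finset.erase_eq_of_notMem hs]
  conv_lhs => rw [← hlaw]
  rw [lintegral_map hH hmeas, lintegral_prod (fun z : (ι → ℕ) × ℕ => H (update z.1 s z.2))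
    (hH.comp hmeas).aemeasurable]

open Function in
/-- Coordinates can be integrated out of a function on which they act as factors. -/
lemma lintegral_infinitePi_prod_mul {ι : Type*} [DecidableEq ι] (ν : ι → Measure ℕ)
    [∀ i, IsProbabilityMeasure (ν i)] {e : ℕ → ι} (he : Injective e) (S : Finset ℕ)
    (φ : ℕ → ℕ → ENNReal) {Q : (ι → ℕ) → ENNReal} (hQ : Measurable Q)
    (hinv : ∀ i w x, Q (update w (e i) x) = Q w) :
    ∫⁻ w, (∏ i ∈ S, φ i (w (e i))) * Q w ∂(Measure.infinitePi ν)
      = (∏ i ∈ S, ∫⁻ x, φ i x ∂(ν (e i))) * ∫⁻ w, Q w ∂(Measure.infinitePi ν) := by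
  induction S using Finset.induction_on with
  | empty => simp
  | insert i S hi ih =>
    have hm : ∀ i, Measurable fun w : ι → ℕ => φ i (w (e i)) := fun i =>
      (measurable_of_countable (φ i)).comp (measurable_pi_apply _)
    have hp : Measurable fun w : ι → ℕ => ∏ i ∈ S, φ i (w (e i)) :=
      Finset.measurable_prod _ fun i _ => hm i
    have hp' : Measurable fun w : ι → ℕ => ∏ i ∈ insert i S, φ i (w (e i)) :=
      Finset.measurable_prod _ fun i _ => hm i
    rw [lintegral_infinitePi_resample ν (e i) (hp'.fun_mul hQ), Finset.prod_insert hi, mul_assoc, ← ih,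
      ← lintegral_const_mul _ (hp.fun_mul hQ)]
    refine lintegral_congr fun w => ?_
    have h1 : ∀ x, (∏ k ∈ insert i S, φ k (update w (e i) x (e k))) * Q (update w (e i) x)
        = φ i x * ((∏ k ∈ S, φ k (w (e k))) * Q w) := by
      intro x
      rw [Finset.prod_insert hi, hinv, mul_assoc, update_self]
      congr 2
      refine Finset.prod_congr rfl fun k hk => ?_
      rw [update_of_ne]
      exact fun h => hi (he h ▸ hk)
    simp_rw [h1]
    rw [lintegral_mul_const _ (measurable_of_countable _)]

/-! ### The stationary model with boundaries -/

/-- The coordinates of the model with boundaries: bulk sites, south boundary edges, west boundary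
edges. -/
abbrev BSite : Type := (ℕ × ℕ) ⊕ (ℕ ⊕ ℕ)

/-- The weights of the bulk sites. -/
def bulk (w : BSite → ℕ) : ℕ × ℕ → ℕ := fun v => w (Sum.inl v)

/-- The increments along the south boundary. -/
def south (w : BSite → ℕ) : ℕ → ℕ := fun i => w (Sum.inr (Sum.inl i))

/-- The increments along the west boundary. -/
def west (w : BSite → ℕ) : ℕ → ℕ := fun j => w (Sum.inr (Sum.inr j))

/-- The laws of the coordinates: `κ` in the bulk, `ν` on the south and `η` on the west boundary. -/
def bLaw (κ ν η : Measure ℕ) : BSite → Measure ℕ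
  | Sum.inl _ => κ
  | Sum.inr (Sum.inl _) => ν
  | Sum.inr (Sum.inr _) => η

instance (κ ν η : Measure ℕ) [IsProbabilityMeasure κ] [IsProbabilityMeasure ν]
    [IsProbabilityMeasure η] (s : BSite) : IsProbabilityMeasure (bLaw κ ν η s) := by
  rcases s with _ | _ | _ <;> simp only [bLaw] <;> infer_instance

/-- The Burke property: independent increments with laws `ν` (horizontal) and `η` (vertical) keep
their joint law when they are updated across a site whose weight has law `κ`. -/
def IsBurke (κ ν η : Measure ℕ) : Prop :=
  ∀ f h : ℕ → ENNReal,
    ∫⁻ a, ∫⁻ b, ∫⁻ k, f (stepI a b k) * h (stepJ a b k) ∂κ ∂η ∂ν = (∫⁻ a, f a ∂ν) * ∫⁻ b, h b ∂η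

lemma queue_congr (a : ℕ → ℕ) (b : ℕ) {r r' : ℕ → ℕ} (i : ℕ) (h : ∀ k < i, r k = r' k) :
    queue a b r i = queue a b r' i := by
  induction i with
  | zero => rfl
  | succ i ih => simp only [queue]; rw [ih fun k hk => h k (by omega), h i (by omega)]

lemma rowInc_congr (a : ℕ → ℕ) {b b' : ℕ → ℕ} {w w' : ℕ × ℕ → ℕ} (j : ℕ)
    (hb : ∀ l < j, b l = b' l) (hw : ∀ i, ∀ l < j, w (i, l) = w' (i, l)) :
    rowInc a b w j = rowInc a b' w' j := by
  induction j with
  | zero => rfl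
  | succ j ih =>
    simp only [rowInc]
    rw [ih (fun l hl => hb l (by omega)) fun i l hl => hw i l (by omega), hb j (by omega)]
    simp only [hw _ j (Nat.lt_succ_self j)]

/-- The horizontal increments as functions of the coordinates. -/
def rInc (w : BSite → ℕ) (j i : ℕ) : ℕ := rowInc (south w) (west w) (bulk w) j i

/-- The vertical increments as functions of the coordinates. -/
def cInc (w : BSite → ℕ) (j i : ℕ) : ℕ := colInc (south w) (west w) (bulk w) j i

lemma measurable_nat_map₃ {α : Type*} [MeasurableSpace α] {β : Type*} [MeasurableSpace β]
    (F : ℕ → ℕ → ℕ → β) {X Y V : α → ℕ} (hX : Measurable X) (hY : Measurable Y)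
    (hV : Measurable V) : Measurable fun w => F (X w) (Y w) (V w) :=
  (measurable_of_countable fun z : ℕ × ℕ × ℕ => F z.1 z.2.1 z.2.2).comp
    (hX.prodMk (hY.prodMk hV))

lemma measurable_inc (j : ℕ) : (∀ i, Measurable fun w => rInc w j i) ∧
    ∀ i, Measurable fun w => cInc w j i := by
  have hq : ∀ j, (∀ i, Measurable fun w => rInc w j i) → ∀ i, Measurable fun w => cInc w j i := by
    intro j hr i
    induction i with
    | zero => exact measurable_pi_apply _
    | succ i ih => exact measurable_nat_map₃ stepJ (hr i) ih (measurable_pi_apply _)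
  have hr : ∀ j i, Measurable fun w => rInc w j i := by
    intro j
    induction j with
    | zero => exact fun i => measurable_pi_apply _
    | succ j ih => exact fun i => measurable_nat_map₃ stepI (ih i) (hq j ih i) (measurable_pi_apply _)
  exact ⟨hr j, hq j (hr j)⟩

lemma measurable_rInc (j i : ℕ) : Measurable fun w => rInc w j i := (measurable_inc j).1 i

lemma measurable_cInc (j i : ℕ) : Measurable fun w => cInc w j i := (measurable_inc j).2 i

section Update

open Function

lemma bulk_update_inr (w : BSite → ℕ) (s : ℕ ⊕ ℕ) (x : ℕ) :
    bulk (update w (Sum.inr s) x) = bulk w := by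
  funext v; simp [bulk]

lemma south_update_inl (w : BSite → ℕ) (v : ℕ × ℕ) (x : ℕ) :
    south (update w (Sum.inl v) x) = south w := by
  funext i; simp [south]

lemma west_update_inl (w : BSite → ℕ) (v : ℕ × ℕ) (x : ℕ) :
    west (update w (Sum.inl v) x) = west w := by
  funext i; simp [west]

lemma bulk_update_inl (w : BSite → ℕ) (v : ℕ × ℕ) (x : ℕ) :
    bulk (update w (Sum.inl v) x) = update (bulk w) v x := by
  funext v'
  by_cases h : v' = v
  · subst h; simp [bulk]
  · simp [bulk, h]

lemma rInc_update_inl (w : BSite → ℕ) (i j x : ℕ) :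
    rInc (update w (Sum.inl (i, j)) x) j = rInc w j := by
  funext k
  simp only [rInc, south_update_inl, west_update_inl, bulk_update_inl]
  rw [rowInc_congr (w' := bulk w) _ j (fun _ _ => rfl)]
  intro i' l hl
  rw [update_of_ne]
  intro h; simp at h; omega

lemma cInc_update_inl (w : BSite → ℕ) (i j x k : ℕ) (hk : k ≤ i) :
    cInc (update w (Sum.inl (i + 1, j)) x) j k = cInc w j k := by
  have h1 := rInc_update_inl w (i + 1) j x
  have h2 : rowInc (south (update w (Sum.inl (i + 1, j)) x))
      (west (update w (Sum.inl (i + 1, j)) x)) (bulk (update w (Sum.inl (i + 1, j)) x)) j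
      = rowInc (south w) (west w) (bulk w) j := h1
  simp only [cInc, colInc]
  rw [h2, west_update_inl, bulk_update_inl]
  refine queue_congr _ _ _ fun l hl => ?_
  rw [update_of_ne]
  intro h; simp at h; omega

lemma rInc_succ_update_inl (w : BSite → ℕ) (i j x k : ℕ) (hk : k < i) :
    rInc (update w (Sum.inl (i + 1, j)) x) (j + 1) k = rInc w (j + 1) k := by
  have h1 : rInc (update w (Sum.inl (i + 1, j)) x) (j + 1) k
      = stepI (rInc (update w (Sum.inl (i + 1, j)) x) j k)
        (cInc (update w (Sum.inl (i + 1, j)) x) j k)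
        (bulk (update w (Sum.inl (i + 1, j)) x) (k + 1, j)) := rfl
  rw [h1, rInc_update_inl, cInc_update_inl w i j x k hk.le, bulk_update_inl, update_of_ne]
  · rfl
  · intro h; simp at h; omega

lemma rInc_update_west (w : BSite → ℕ) (j x : ℕ) :
    rInc (update w (Sum.inr (Sum.inr j)) x) j = rInc w j := by
  funext k
  simp only [rInc, bulk_update_inr]
  have h : south (update w (Sum.inr (Sum.inr j)) x) = south w := by
    funext i; simp [south]
  rw [h, rowInc_congr (b' := west w) (w' := bulk w) _ j _ fun _ _ _ => rfl]
  intro l hl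
  simp [west, hl.ne]

end Update

section Stationarity

variable {κ ν η : Measure ℕ} [IsProbabilityMeasure κ] [IsProbabilityMeasure ν]
  [IsProbabilityMeasure η]

open Function in
/-- The mixed product formula behind the invariance: along the down-right path that follows height
`j + 1` up to column `i`, steps down, and continues at height `j`, the increments are independent
with laws `ν` and `η`. Increasing `i` is one application of the Burke property. -/
lemma lintegral_prod_mixed (hB : IsBurke κ ν η) (m j : ℕ)
    (hj : ∀ g : ℕ → ℕ → ENNReal, ∫⁻ w, ∏ i ∈ Finset.range m, g i (rInc w j i)
      ∂(Measure.infinitePi (bLaw κ ν η)) = ∏ i ∈ Finset.range m, ∫⁻ x, g i x ∂ν)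
    (i : ℕ) (hi : i ≤ m) (f g : ℕ → ℕ → ENNReal) (h : ℕ → ENNReal) :
    ∫⁻ w, (∏ k ∈ Finset.range i, f k (rInc w (j + 1) k)) * h (cInc w j i) *
        ∏ k ∈ Finset.Ico i m, g k (rInc w j k) ∂(Measure.infinitePi (bLaw κ ν η))
      = (∏ k ∈ Finset.range i, ∫⁻ x, f k x ∂ν) * (∫⁻ x, h x ∂η) *
        ∏ k ∈ Finset.Ico i m, ∫⁻ x, g k x ∂ν := by
  have hmr : ∀ (F : ℕ → ENNReal) (j k : ℕ), Measurable fun w => F (rInc w j k) := fun F j k =>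
    (measurable_of_countable F).comp (measurable_rInc j k)
  have hmc : ∀ (F : ℕ → ENNReal) (j k : ℕ), Measurable fun w => F (cInc w j k) := fun F j k =>
    (measurable_of_countable F).comp (measurable_cInc j k)
  have hpr : ∀ (F : ℕ → ℕ → ENNReal) (j : ℕ) (S : Finset ℕ),
      Measurable fun w => ∏ k ∈ S, F k (rInc w j k) := fun F j S =>
    Finset.measurable_prod _ fun k _ => hmr (F k) j k
  induction i generalizing f g h with
  | zero =>
    simp only [Finset.range_zero, Finset.prod_empty, one_mul, ← Finset.range_eq_Ico]
    rw [← hj g]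
    rw [lintegral_infinitePi_resample (bLaw κ ν η) (Sum.inr (Sum.inr j))
      ((hmc h j 0).fun_mul (hpr g j _)), ← lintegral_const_mul _ (hpr g j _)]
    refine lintegral_congr fun w => ?_
    have h0 : ∀ x, cInc (update w (Sum.inr (Sum.inr j)) x) j 0 = x := by
      intro x; simp [cInc, colInc_zero, west]
    simp_rw [h0, rInc_update_west]
    rw [lintegral_mul_const _ (measurable_of_countable _)]
    rfl
  | succ i ih =>
    have hi' : i < m := hi
    set P := Measure.infinitePi (bLaw κ ν η) with hP
    set Q : (BSite → ℕ) → ENNReal := fun w => ∏ k ∈ Finset.range i, f k (rInc w (j + 1) k) with hQ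
    set S : (BSite → ℕ) → ENNReal := fun w => ∏ k ∈ Finset.Ico (i + 1) m, g k (rInc w j k) with hS
    set ψ : ℕ → ℕ → ENNReal := fun a b => ∫⁻ k, f i (stepI a b k) * h (stepJ a b k) ∂κ with hψ
    have hQm : Measurable Q := hpr f (j + 1) _
    have hSm : Measurable S := hpr g j _
    have step1 : ∫⁻ w, (∏ k ∈ Finset.range (i + 1), f k (rInc w (j + 1) k)) * h (cInc w j (i + 1)) *
        ∏ k ∈ Finset.Ico (i + 1) m, g k (rInc w j k) ∂P
        = ∫⁻ w, Q w * S w * ψ (rInc w j i) (cInc w j i) ∂P := by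
      rw [hP, lintegral_infinitePi_resample (bLaw κ ν η) (Sum.inl (i + 1, j))
        (((hpr f (j + 1) _).fun_mul (hmc h j (i + 1))).fun_mul (hpr g j _))]
      refine lintegral_congr fun w => ?_
      have e1 : ∀ x, rInc (update w (Sum.inl (i + 1, j)) x) (j + 1) i
          = stepI (rInc w j i) (cInc w j i) x := by
        intro x
        rw [← rInc_update_inl w (i + 1) j x, ← cInc_update_inl w i j x i le_rfl]
        simp [rInc, cInc, rowInc_succ, bulk]
      have e2 : ∀ x, cInc (update w (Sum.inl (i + 1, j)) x) j (i + 1)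
          = stepJ (rInc w j i) (cInc w j i) x := by
        intro x
        rw [← rInc_update_inl w (i + 1) j x, ← cInc_update_inl w i j x i le_rfl]
        simp [rInc, cInc, colInc_succ, bulk]
      have e3 : ∀ x, ∏ k ∈ Finset.range i, f k (rInc (update w (Sum.inl (i + 1, j)) x) (j + 1) k)
          = Q w := fun x => Finset.prod_congr rfl fun k hk => by
        rw [rInc_succ_update_inl w i j x k (Finset.mem_range.1 hk)]
      simp_rw [Finset.prod_range_succ, e1, e2, e3, rInc_update_inl]
      rw [hψ, ← lintegral_const_mul _ (measurable_of_countable _)]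
      refine lintegral_congr fun x => ?_
      ring
    have step2 : ∀ w, Q w * S w * ψ (rInc w j i) (cInc w j i)
        = ∑' a, Q w * ψ a (cInc w j i) * ∏ k ∈ Finset.Ico i m,
          (if k = i then fun x => if x = a then 1 else 0 else g k) (rInc w j k) := by
      intro w
      rw [tsum_eq_single (rInc w j i)]
      · rw [Finset.prod_eq_prod_Ico_succ_bot hi']
        simp only [if_true, one_mul]
        rw [mul_right_comm]
        congr 1
        refine Finset.prod_congr rfl fun k hk => ?_
        rw [if_neg (by have := (Finset.mem_Ico.1 hk).1; omega)]
      · intro a ha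
        rw [Finset.prod_eq_prod_Ico_succ_bot hi']
        simp [Ne.symm ha]
    rw [step1]
    simp_rw [step2]
    rw [lintegral_tsum fun a => ((hQm.fun_mul (hmc (ψ a) j i)).fun_mul (hpr _ j _)).aemeasurable]
    simp_rw [hQ]
    have step3 : ∀ a, ∫⁻ w, (∏ k ∈ Finset.range i, f k (rInc w (j + 1) k)) * ψ a (cInc w j i) *
          ∏ k ∈ Finset.Ico i m, (if k = i then fun x => if x = a then 1 else 0 else g k)
            (rInc w j k) ∂P
        = (∏ k ∈ Finset.range i, ∫⁻ x, f k x ∂ν) *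
          (∏ k ∈ Finset.Ico (i + 1) m, ∫⁻ x, g k x ∂ν) * ((∫⁻ b, ψ a b ∂η) * ν {a}) := by
      intro a
      rw [ih hi'.le, Finset.prod_eq_prod_Ico_succ_bot hi']
      have e1 : ∏ k ∈ Finset.Ico (i + 1) m,
          ∫⁻ x, (if k = i then fun x => if x = a then (1 : ENNReal) else 0 else g k) x ∂ν
          = ∏ k ∈ Finset.Ico (i + 1) m, ∫⁻ x, g k x ∂ν :=
        Finset.prod_congr rfl fun k hk => by
          rw [if_neg (by have := (Finset.mem_Ico.1 hk).1; omega)]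
      have e2 : ∫⁻ x, (if i = i then fun x => if x = a then (1 : ENNReal) else 0 else g i) x ∂ν
          = ν {a} := by
        rw [if_pos rfl, ← lintegral_indicator_one (measurableSet_singleton a)]
        refine lintegral_congr fun x => ?_
        simp [Set.indicator_apply]
      rw [e1, e2]
      ring
    simp_rw [step3]
    rw [ENNReal.tsum_mul_left, ← lintegral_countable' (fun a => ∫⁻ b, ψ a b ∂η), hψ, hB,
      Finset.prod_range_succ]
    ring

/-- Stationarity: at every height, the horizontal increments are independent with law `ν`. -/
lemma lintegral_prod_rInc (hB : IsBurke κ ν η) (m j : ℕ) (f : ℕ → ℕ → ENNReal) :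
    ∫⁻ w, ∏ i ∈ Finset.range m, f i (rInc w j i) ∂(Measure.infinitePi (bLaw κ ν η))
      = ∏ i ∈ Finset.range m, ∫⁻ x, f i x ∂ν := by
  induction j generalizing f with
  | zero =>
    have he : Function.Injective (fun i : ℕ => (Sum.inr (Sum.inl i) : BSite)) := fun i k h => by
      simpa using h
    have h := lintegral_infinitePi_prod_mul (bLaw κ ν η) he (Finset.range m) f
      (Q := fun _ => 1) measurable_const (fun _ _ _ => rfl)
    simp only [mul_one, lintegral_const, measure_univ] at h
    exact h
  | succ j ih =>
    have h := lintegral_prod_mixed hB m j ih m le_rfl f f (fun _ => 1)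
    simpa using h

end Stationarity

/-! ### Exponential moments and exit points -/

/-- The exponential moment `E x ^ G` of the last passage time through `m` columns and `n` rows with
independent weights of law `κ`. -/
noncomputable def expMoment (κ : Measure ℕ) (x : ENNReal) (m n : ℕ) : ENNReal :=
  ∫⁻ w, x ^ lpp w m n ∂(Measure.infinitePi fun _ : ℕ × ℕ => κ)

lemma measurable_lpp (m n : ℕ) : Measurable fun w : ℕ × ℕ → ℕ => lpp w m n := by
  induction m generalizing n with
  | zero => simp
  | succ m ihm =>
    induction n with
    | zero => simp
    | succ n ihn =>
      simp only [lpp_succ_succ]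
      exact measurable_nat_map₃ (fun a b c => max a (b + c)) ihn (ihm _) (measurable_pi_apply _)

lemma shiftEnv_add_injective (c : ℕ × ℕ) :
    Function.Injective fun v : ℕ × ℕ => c + v := fun _ _ h => add_left_cancel h

section Exit

variable {κ ν η : Measure ℕ} [IsProbabilityMeasure κ] [IsProbabilityMeasure ν]
  [IsProbabilityMeasure η]

lemma lintegral_pow_lpp_shift_bulk (x : ENNReal) (c : ℕ × ℕ) (m n : ℕ) :
    ∫⁻ w, x ^ lpp (shiftEnv c (bulk w)) m n ∂(Measure.infinitePi (bLaw κ ν η))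
      = expMoment κ x m n := by
  have hinj : Function.Injective fun v : ℕ × ℕ => (Sum.inl (c + v) : BSite) := fun _ _ h =>
    shiftEnv_add_injective c (Sum.inl_injective h)
  have hlaw := Measure.map_infinitePi_infinitePi_of_inj (P := bLaw κ ν η) hinj
  have hlaw' : (Measure.infinitePi (bLaw κ ν η)).map (fun w => shiftEnv c (bulk w))
      = Measure.infinitePi fun _ : ℕ × ℕ => κ := hlaw
  have hm : Measurable fun w : BSite → ℕ => shiftEnv c (bulk w) :=
    measurable_pi_iff.2 fun v => measurable_pi_apply _
  have hf : Measurable fun w : ℕ × ℕ → ℕ => x ^ lpp w m n :=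
    (measurable_of_countable fun k : ℕ => x ^ k).comp (measurable_lpp m n)
  rw [expMoment, ← hlaw', lintegral_map hf hm]

lemma measurable_pow_lpp_shift_bulk (x : ENNReal) (c : ℕ × ℕ) (m n : ℕ) :
    Measurable fun w : BSite → ℕ => x ^ lpp (shiftEnv c (bulk w)) m n :=
  ((measurable_of_countable fun k : ℕ => x ^ k).comp (measurable_lpp m n)).comp
    (measurable_pi_iff.2 fun _ => measurable_pi_apply _ :
      Measurable fun w : BSite → ℕ => shiftEnv c (bulk w))

lemma measurable_prod_coord (S : Finset ℕ) (e : ℕ → BSite) (y : ENNReal) :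
    Measurable fun w : BSite → ℕ => ∏ j ∈ S, y ^ w (e j) :=
  Finset.measurable_prod _ fun j _ =>
    (measurable_of_countable fun k : ℕ => y ^ k).comp (measurable_pi_apply (e j))

/-- Boundary increments and bulk are independent, so exponential moments factorize. -/
lemma lintegral_boundary_mul_bulk (x y : ENNReal) (S T : Finset ℕ) (c : ℕ × ℕ) (m n : ℕ) :
    ∫⁻ w, (∏ i ∈ S, x ^ south w i) * ((∏ j ∈ T, y ^ west w j) *
        x ^ lpp (shiftEnv c (bulk w)) m n) ∂(Measure.infinitePi (bLaw κ ν η))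
      = (∫⁻ a, x ^ a ∂ν) ^ S.card * ((∫⁻ b, y ^ b ∂η) ^ T.card * expMoment κ x m n) := by
  have h1 := lintegral_infinitePi_prod_mul (bLaw κ ν η)
    (e := fun i => Sum.inr (Sum.inl i)) (fun i k h => by simpa using h) S (fun _ k => x ^ k)
    (Q := fun w => (∏ j ∈ T, y ^ west w j) * x ^ lpp (shiftEnv c (bulk w)) m n)
    ((measurable_prod_coord T (fun j => Sum.inr (Sum.inr j)) y).fun_mul
      (measurable_pow_lpp_shift_bulk x c m n)) (fun i w k => by simp [bulk_update_inr, west])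
  have h2 := lintegral_infinitePi_prod_mul (bLaw κ ν η)
    (e := fun j => Sum.inr (Sum.inr j)) (fun i k h => by simpa using h) T (fun _ k => y ^ k)
    (Q := fun w => x ^ lpp (shiftEnv c (bulk w)) m n)
    (measurable_pow_lpp_shift_bulk x c m n) (fun i w k => by simp [bulk_update_inr])
  rw [lintegral_pow_lpp_shift_bulk] at h2
  simp only [bLaw, Finset.prod_const] at h1 h2
  refine h1.trans ?_
  congr 1

lemma lintegral_pow_sum_rInc (hB : IsBurke κ ν η) (x : ENNReal) (m n : ℕ) :
    ∫⁻ w, x ^ (∑ i ∈ Finset.range m, rInc w n i) ∂(Measure.infinitePi (bLaw κ ν η))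
      = (∫⁻ a, x ^ a ∂ν) ^ m := by
  have h := lintegral_prod_rInc hB m n (fun _ k => x ^ k)
  simp only [Finset.prod_pow_eq_pow_sum, Finset.prod_const, Finset.card_range] at h
  exact h

lemma pow_sum_rInc_eq {x y : ENNReal} (hxy : x * y = 1) (w : BSite → ℕ) (m n : ℕ) :
    x ^ (∑ i ∈ Finset.range m, rInc w n i)
      = x ^ blpp (south w) (west w) (bulk w) m n * y ^ (∑ j ∈ Finset.range n, west w j) := by
  have h : blpp (south w) (west w) (bulk w) m n
      = ∑ j ∈ Finset.range n, west w j + ∑ i ∈ Finset.range m, rInc w n i := rfl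
  rw [h, pow_add, mul_right_comm, ← mul_pow, hxy, one_pow, one_mul]

/-- The boundaries only increase the passage time; the west boundary is subtracted again. -/
lemma expMoment_mul_le (hB : IsBurke κ ν η) {x y : ENNReal} (hx : 1 ≤ x) (hxy : x * y = 1)
    (m n : ℕ) :
    (∫⁻ b, y ^ b ∂η) ^ n * expMoment κ x m n ≤ (∫⁻ a, x ^ a ∂ν) ^ m := by
  have h := lintegral_boundary_mul_bulk (κ := κ) (ν := ν) (η := η) x y ∅ (Finset.range n) 0 m n
  simp only [Finset.prod_empty, one_mul, Finset.card_empty, pow_zero, Finset.card_range] at h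
  rw [← h, ← lintegral_pow_sum_rInc hB x m n]
  refine lintegral_mono fun w => ?_
  rw [pow_sum_rInc_eq hxy, mul_comm, Finset.prod_pow_eq_pow_sum]
  have h0 : shiftEnv 0 (bulk w) = bulk w := by funext v; simp [shiftEnv]
  rw [h0]
  gcongr
  exact lpp_le_blpp _ _ _ _ _

/-- Splitting according to the point where the maximizing path leaves the boundary. -/
lemma le_sum_exit (hB : IsBurke κ ν η) {x y : ENNReal} (hx : 1 ≤ x) (hxy : x * y = 1)
    (m n : ℕ) :
    (∫⁻ a, x ^ a ∂ν) ^ m ≤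
      ∑ k ∈ Finset.range (m + 1), (∫⁻ a, x ^ a ∂ν) ^ k *
          ((∫⁻ b, y ^ b ∂η) ^ n * expMoment κ x (m - k) n) +
      ∑ l ∈ Finset.range n, (∫⁻ b, y ^ b ∂η) ^ (n - (l + 1)) * expMoment κ x m (n - l) := by
  set P := Measure.infinitePi (bLaw κ ν η) with hP
  have hS : ∀ k, ∫⁻ w, (∏ i ∈ Finset.range k, x ^ south w i) *
      ((∏ j ∈ Finset.range n, y ^ west w j) * x ^ lpp (shiftEnv (k, 0) (bulk w)) (m - k) n) ∂P
      = (∫⁻ a, x ^ a ∂ν) ^ k * ((∫⁻ b, y ^ b ∂η) ^ n * expMoment κ x (m - k) n) := by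
    intro k
    rw [hP, lintegral_boundary_mul_bulk, Finset.card_range, Finset.card_range]
  have hW : ∀ l, ∫⁻ w, (∏ j ∈ Finset.Ico (l + 1) n, y ^ west w j) *
      x ^ lpp (shiftEnv (0, l) (bulk w)) m (n - l) ∂P
      = (∫⁻ b, y ^ b ∂η) ^ (n - (l + 1)) * expMoment κ x m (n - l) := by
    intro l
    have h := lintegral_boundary_mul_bulk (κ := κ) (ν := ν) (η := η) x y ∅
      (Finset.Ico (l + 1) n) (0, l) m (n - l)
    simpa using h
  simp_rw [← hS, ← hW]
  have hmS : ∀ k, Measurable fun w : BSite → ℕ => (∏ i ∈ Finset.range k, x ^ south w i) *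
      ((∏ j ∈ Finset.range n, y ^ west w j) * x ^ lpp (shiftEnv (k, 0) (bulk w)) (m - k) n) :=
    fun k => (measurable_prod_coord _ (fun i => Sum.inr (Sum.inl i)) x).fun_mul
      ((measurable_prod_coord _ (fun j => Sum.inr (Sum.inr j)) y).fun_mul
        (measurable_pow_lpp_shift_bulk x (k, 0) (m - k) n))
  have hmW : ∀ l, Measurable fun w : BSite → ℕ => (∏ j ∈ Finset.Ico (l + 1) n, y ^ west w j) *
      x ^ lpp (shiftEnv (0, l) (bulk w)) m (n - l) :=
    fun l => (measurable_prod_coord _ (fun j => Sum.inr (Sum.inr j)) y).fun_mul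
      (measurable_pow_lpp_shift_bulk x (0, l) m (n - l))
  rw [← lintegral_finsetSum _ fun k _ => hmS k, ← lintegral_finsetSum _ fun l _ => hmW l,
    ← lintegral_add_left (Finset.measurable_sum _ fun k _ => hmS k),
    ← lintegral_pow_sum_rInc hB x m n]
  refine lintegral_mono fun w => ?_
  rw [pow_sum_rInc_eq hxy]
  rcases blpp_le_exit (south w) (west w) (bulk w) m n with ⟨k, hk, h⟩ | ⟨l, hl, h⟩
  · refine le_trans ?_ le_self_add
    refine le_trans ?_ (Finset.single_le_sum (fun _ _ => zero_le)
      (Finset.mem_range.2 (Nat.lt_succ_of_le hk)))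
    rw [Finset.prod_pow_eq_pow_sum, Finset.prod_pow_eq_pow_sum]
    calc _ ≤ x ^ (∑ i ∈ Finset.range k, south w i + lpp (shiftEnv (k, 0) (bulk w)) (m - k) n) *
          y ^ (∑ j ∈ Finset.range n, west w j) := by
          gcongr
      _ = _ := by rw [pow_add]; ring
  · refine le_trans ?_ le_add_self
    refine le_trans ?_ (Finset.single_le_sum (fun _ _ => zero_le) (Finset.mem_range.2 hl))
    rw [Finset.prod_pow_eq_pow_sum]
    have hsplit : ∑ j ∈ Finset.range n, west w j
        = ∑ j ∈ Finset.range (l + 1), west w j + ∑ j ∈ Finset.Ico (l + 1) n, west w j :=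
      (Finset.sum_range_add_sum_Ico _ hl).symm
    calc _ ≤ x ^ (∑ j ∈ Finset.range (l + 1), west w j + lpp (shiftEnv (0, l) (bulk w)) m (n - l)) *
          y ^ (∑ j ∈ Finset.range n, west w j) := by
          gcongr
      _ = (x * y) ^ (∑ j ∈ Finset.range (l + 1), west w j) *
          (y ^ (∑ j ∈ Finset.Ico (l + 1) n, west w j) *
            x ^ lpp (shiftEnv (0, l) (bulk w)) m (n - l)) := by
          rw [hsplit, pow_add, pow_add, mul_pow]; ring
      _ = _ := by rw [hxy, one_pow, one_mul]

end Exit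

/-! ### The Burke property of Bernoulli and geometric increments -/

/-- The Bernoulli law on `{0, 1} ⊆ ℕ` with success probability `p`. -/
noncomputable def bern (p : ℝ) : Measure ℕ :=
  ENNReal.ofReal p • Measure.dirac 1 + ENNReal.ofReal (1 - p) • Measure.dirac 0

/-- The geometric law on `ℕ` with weights `(1 - q) q ^ k`. -/
noncomputable def geom (q : ℝ) : Measure ℕ :=
  Measure.sum fun k => (ENNReal.ofReal (1 - q) * ENNReal.ofReal q ^ k) • Measure.dirac k

lemma lintegral_bern (p : ℝ) (f : ℕ → ENNReal) :
    ∫⁻ a, f a ∂(bern p) = ENNReal.ofReal p * f 1 + ENNReal.ofReal (1 - p) * f 0 := by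
  simp [bern, lintegral_add_measure]

lemma lintegral_geom (q : ℝ) (f : ℕ → ENNReal) :
    ∫⁻ a, f a ∂(geom q) = ∑' k, ENNReal.ofReal (1 - q) * ENNReal.ofReal q ^ k * f k := by
  simp [geom, lintegral_sum_measure]

lemma isProbabilityMeasure_bern {p : ℝ} (h0 : 0 ≤ p) (h1 : p ≤ 1) :
    IsProbabilityMeasure (bern p) := by
  refine ⟨?_⟩
  rw [← lintegral_one, lintegral_bern, mul_one, mul_one, ← ENNReal.ofReal_add h0 (by linarith)]
  simp

lemma lintegral_geom_pow {q y : ℝ} (h0 : 0 ≤ q) (h1 : q < 1) (hy0 : 0 ≤ y) (hy1 : y ≤ 1) :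
    ∫⁻ b, ENNReal.ofReal y ^ b ∂(geom q) = ENNReal.ofReal ((1 - q) / (1 - q * y)) := by
  have hqy : q * y < 1 := by nlinarith
  rw [lintegral_geom]
  simp_rw [mul_assoc, ← mul_pow]
  rw [ENNReal.tsum_mul_left, ENNReal.tsum_geometric, ← ENNReal.ofReal_mul h0,
    ← ENNReal.ofReal_one, ← ENNReal.ofReal_sub _ (by positivity),
    ← ENNReal.ofReal_inv_of_pos (by linarith), ← ENNReal.ofReal_mul (by linarith), div_eq_mul_inv]

lemma isProbabilityMeasure_geom {q : ℝ} (h0 : 0 ≤ q) (h1 : q < 1) :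
    IsProbabilityMeasure (geom q) := by
  refine ⟨?_⟩
  have h := lintegral_geom_pow h0 h1 zero_le_one le_rfl
  rw [mul_one, div_self (by linarith), ENNReal.ofReal_one] at h
  simpa using h

/-- The parameter of the geometric increments that is in equilibrium with Bernoulli(`u`) increments:
the vertical increment performs a reflected walk with up-probability `p (1 - u)` and
down-probability `u (1 - p)`. -/
noncomputable def qpar (p u : ℝ) : ℝ := p * (1 - u) / (u * (1 - p))

lemma qpar_nonneg {p u : ℝ} (hp0 : 0 < p) (hpu : p < u) (hu : u < 1) : 0 ≤ qpar p u :=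
  div_nonneg (mul_nonneg hp0.le (by linarith)) (mul_nonneg (by linarith) (by linarith))

lemma qpar_lt_one {p u : ℝ} (hp0 : 0 < p) (hpu : p < u) (hu : u < 1) : qpar p u < 1 := by
  have : 0 < u * (1 - p) := mul_pos (by linarith) (by linarith)
  rw [qpar, div_lt_one this]
  nlinarith

lemma isBurke_bern_geom {p u : ℝ} (hp0 : 0 < p) (hpu : p < u) (hu : u < 1) :
    IsBurke (bern p) (bern u) (geom (qpar p u)) := by
  intro f h
  have hP : ENNReal.ofReal p + ENNReal.ofReal (1 - p) = 1 := by
    rw [← ENNReal.ofReal_add hp0.le (by linarith)]; simp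
  have hUP : ENNReal.ofReal (1 - u) * ENNReal.ofReal p
      = ENNReal.ofReal u * ENNReal.ofReal (1 - p) * ENNReal.ofReal (qpar p u) := by
    rw [← ENNReal.ofReal_mul (by linarith), ← ENNReal.ofReal_mul (by linarith),
      ← ENNReal.ofReal_mul (mul_nonneg (by linarith) (by linarith)), qpar,
      mul_div_cancel₀ _ (mul_pos (by linarith) (by linarith)).ne', mul_comm]
  simp only [lintegral_bern, lintegral_geom]
  set P1 := ENNReal.ofReal p
  set P0 := ENNReal.ofReal (1 - p)
  set U1 := ENNReal.ofReal u
  set U0 := ENNReal.ofReal (1 - u)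
  set q := ENNReal.ofReal (qpar p u)
  set c := ENNReal.ofReal (1 - qpar p u)
  set S := ∑' k, c * q ^ k * h k with hS
  set V := ∑' k, c * q ^ k * h (k + 1) with hV
  have hSV : S = c * h 0 + q * V := by
    rw [hS, tsum_eq_zero_add' ENNReal.summable, hV, ← ENNReal.tsum_mul_left]
    simp only [pow_zero, mul_one]
    congr 1
    refine tsum_congr fun k => ?_
    rw [pow_succ]; ring
  have h1 : ∑' k, c * q ^ k * (P1 * (f (stepI 1 k 1) * h (stepJ 1 k 1)) +
      P0 * (f (stepI 1 k 0) * h (stepJ 1 k 0)))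
      = P1 * f 1 * S + P0 * (c * f 1 * h 0 + f 0 * q * S) := by
    have e1 : ∀ k, c * q ^ k * (P1 * (f (stepI 1 k 1) * h (stepJ 1 k 1)) +
        P0 * (f (stepI 1 k 0) * h (stepJ 1 k 0)))
        = P1 * f 1 * (c * q ^ k * h k) + P0 * (c * q ^ k * (f (1 - k) * h (k - 1))) := by
      intro k
      have i1 : stepI 1 k 1 = 1 := by simp only [stepI]; omega
      have i2 : stepJ 1 k 1 = k := by simp only [stepJ]; omega
      have i3 : stepI 1 k 0 = 1 - k := by simp only [stepI]; omega
      have i4 : stepJ 1 k 0 = k - 1 := by simp only [stepJ]; omega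
      rw [i1, i2, i3, i4]; ring
    simp_rw [e1]
    rw [ENNReal.tsum_add, ENNReal.tsum_mul_left, ENNReal.tsum_mul_left]
    congr 2
    rw [tsum_eq_zero_add' ENNReal.summable, hS, ← ENNReal.tsum_mul_left]
    congr 1
    · simp; ring
    · refine tsum_congr fun k => ?_
      have i1 : 1 - (k + 1) = 0 := by omega
      rw [i1, Nat.add_sub_cancel, pow_succ]; ring
  have h0 : ∑' k, c * q ^ k * (P1 * (f (stepI 0 k 1) * h (stepJ 0 k 1)) +
      P0 * (f (stepI 0 k 0) * h (stepJ 0 k 0))) = P1 * f 1 * V + P0 * f 0 * S := by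
    have e1 : ∀ k, c * q ^ k * (P1 * (f (stepI 0 k 1) * h (stepJ 0 k 1)) +
        P0 * (f (stepI 0 k 0) * h (stepJ 0 k 0)))
        = P1 * f 1 * (c * q ^ k * h (k + 1)) + P0 * f 0 * (c * q ^ k * h k) := by
      intro k
      have i1 : stepI 0 k 1 = 1 := by simp only [stepI]; omega
      have i2 : stepJ 0 k 1 = k + 1 := by simp only [stepJ]; omega
      have i3 : stepI 0 k 0 = 0 := by simp only [stepI]; omega
      have i4 : stepJ 0 k 0 = k := by simp only [stepJ]; omega
      rw [i1, i2, i3, i4]; ring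
    simp_rw [e1]
    rw [ENNReal.tsum_add, ENNReal.tsum_mul_left, ENNReal.tsum_mul_left]
  rw [h1, h0]
  calc U1 * (P1 * f 1 * S + P0 * (c * f 1 * h 0 + f 0 * q * S))
        + U0 * (P1 * f 1 * V + P0 * f 0 * S)
      = U1 * P1 * f 1 * S + U1 * P0 * c * f 1 * h 0 + (U1 * P0 * q) * f 0 * S
        + (U0 * P1) * f 1 * V + U0 * P0 * f 0 * S := by ring
    _ = U1 * P1 * f 1 * S + U1 * P0 * c * f 1 * h 0 + (U0 * P1) * f 0 * S
        + (U1 * P0 * q) * f 1 * V + U0 * P0 * f 0 * S := by rw [hUP]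
    _ = U1 * P1 * f 1 * S + U1 * P0 * f 1 * (c * h 0 + q * V)
        + U0 * f 0 * S * (P1 + P0) := by ring
    _ = (P1 + P0) * (U1 * f 1 * S) + U0 * f 0 * S * (P1 + P0) := by rw [← hSV]; ring
    _ = _ := by rw [hP]; ring

/-! ### The logarithmic moment generating function -/

section Env

variable {Ω : Type*} [MeasurableSpace Ω] {μ : Measure Ω} {p : ℝ} {ω : ℕ × ℕ → Ω → ℕ}

lemma IsBernoulliEnv.isProbabilityMeasure (hω : IsBernoulliEnv μ p ω) : IsProbabilityMeasure μ :=
  hω.indep.isProbabilityMeasure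

lemma IsBernoulliEnv.measure_one_or_zero (hp0 : 0 < p) (hp1 : p < 1) (hω : IsBernoulliEnv μ p ω)
    (v : ℕ × ℕ) : ∀ᵐ x ∂μ, ω v x = 1 ∨ ω v x = 0 := by
  have := hω.isProbabilityMeasure
  have hm : ∀ k, MeasurableSet {x | ω v x = k} := fun k =>
    hω.measurable v (measurableSet_singleton k)
  have hd : Disjoint {x | ω v x = 1} {x | ω v x = 0} :=
    Set.disjoint_left.2 fun x h1 h0 => by simp_all
  have h : μ ({x | ω v x = 1} ∪ {x | ω v x = 0}) = 1 := by
    rw [measure_union hd (hm 0), hω.prob_one, hω.prob_zero,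
      ← ENNReal.ofReal_add hp0.le (by linarith)]
    simp
  exact (prob_compl_eq_zero_iff ((hm 1).union (hm 0))).2 h

lemma IsBernoulliEnv.ae_le_one (hp0 : 0 < p) (hp1 : p < 1) (hω : IsBernoulliEnv μ p ω) :
    ∀ᵐ x ∂μ, ∀ v, ω v x ≤ 1 := by
  rw [ae_all_iff]
  intro v
  filter_upwards [hω.measure_one_or_zero hp0 hp1 v] with x hx
  omega

lemma IsBernoulliEnv.map_eq_bern (hp0 : 0 < p) (hp1 : p < 1) (hω : IsBernoulliEnv μ p ω)
    (v : ℕ × ℕ) : μ.map (ω v) = bern p := by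
  refine Measure.ext_of_singleton fun k => ?_
  rw [Measure.map_apply (hω.measurable v) (measurableSet_singleton k)]
  have hset : ω v ⁻¹' {k} = {x | ω v x = k} := rfl
  rw [hset]
  rcases k with _ | _ | k
  · rw [hω.prob_zero]; simp [bern]
  · rw [hω.prob_one]; simp [bern]
  · have h : μ {x | ω v x = k + 1 + 1} = 0 := by
      refine measure_mono_null ?_ (hω.measure_one_or_zero hp0 hp1 v)
      intro x (hx : ω v x = k + 1 + 1)
      simp only [Set.mem_compl_iff, Set.mem_ofPred_eq]
      omega
    rw [h]
    simp [bern]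

lemma IsBernoulliEnv.map_eq (hp0 : 0 < p) (hp1 : p < 1) (hω : IsBernoulliEnv μ p ω) :
    μ.map (fun x v => ω v x) = Measure.infinitePi fun _ => bern p := by
  rw [hω.indep.map_fun_eq_infinitePi_map hω.measurable]
  simp_rw [hω.map_eq_bern hp0 hp1]

lemma IsBernoulliEnv.measurable_env (hω : IsBernoulliEnv μ p ω) :
    Measurable fun x v => ω v x := measurable_pi_iff.2 hω.measurable

lemma IsBernoulliEnv.lintegral_lastPassage (hp0 : 0 < p) (hp1 : p < 1)
    (hω : IsBernoulliEnv μ p ω) (y : ENNReal) (m n : ℕ) :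
    ∫⁻ x, y ^ lastPassage (fun v => ω v x) m n ∂μ = expMoment (bern p) y m (n + 1) := by
  have hf : Measurable fun w : ℕ × ℕ → ℕ => y ^ lpp w m (n + 1) :=
    (measurable_of_countable fun k : ℕ => y ^ k).comp (measurable_lpp m (n + 1))
  rw [expMoment, ← hω.map_eq hp0 hp1, lintegral_map hf hω.measurable_env]
  simp_rw [lastPassage_eq_lpp]

end Env

/-- `log E exp (ξ G_{m,n})`. -/
noncomputable def logMoment (p ξ : ℝ) (m n : ℕ) : ℝ :=
  Real.log (expMoment (bern p) (ENNReal.ofReal (Real.exp ξ)) m (n + 1)).toReal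

/-- The logarithmic moment generating function of the horizontal increments, Bernoulli(`u`). -/
noncomputable def hLog (ξ u : ℝ) : ℝ := Real.log (1 - u + u * Real.exp ξ)

/-- Minus the logarithmic moment generating function, at `-ξ`, of the vertical increments in
equilibrium with Bernoulli(`u`) horizontal increments. -/
noncomputable def vLog (p ξ u : ℝ) : ℝ :=
  Real.log ((u * (1 - p + p * Real.exp (-ξ)) - p * Real.exp (-ξ)) / (u - p))

lemma hLog_arg_ge_one {ξ u : ℝ} (hξ : 0 ≤ ξ) (hu : 0 ≤ u) : 1 ≤ 1 - u + u * Real.exp ξ := by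
  have := Real.one_le_exp hξ
  nlinarith

lemma hLog_nonneg {ξ u : ℝ} (hξ : 0 ≤ ξ) (hu : 0 ≤ u) : 0 ≤ hLog ξ u :=
  Real.log_nonneg (hLog_arg_ge_one hξ hu)

lemma vLog_arg_ge_one {p ξ u : ℝ} (hp0 : 0 < p) (hξ : 0 ≤ ξ) (hpu : p < u) (hu : u < 1) :
    1 ≤ (u * (1 - p + p * Real.exp (-ξ)) - p * Real.exp (-ξ)) / (u - p) := by
  have h1 : Real.exp (-ξ) ≤ 1 := Real.exp_le_one_iff.2 (by linarith)
  rw [le_div_iff₀ (by linarith)]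
  nlinarith [mul_nonneg (mul_nonneg hp0.le (sub_nonneg.2 hu.le)) (sub_nonneg.2 h1)]

lemma vLog_nonneg {p ξ u : ℝ} (hp0 : 0 < p) (hξ : 0 ≤ ξ) (hpu : p < u) (hu : u < 1) :
    0 ≤ vLog p ξ u := Real.log_nonneg (vLog_arg_ge_one hp0 hξ hpu hu)

lemma lintegral_bern_exp {ξ u : ℝ} (hu0 : 0 ≤ u) (hu1 : u ≤ 1) :
    ∫⁻ a, ENNReal.ofReal (Real.exp ξ) ^ a ∂(bern u)
      = ENNReal.ofReal (1 - u + u * Real.exp ξ) := by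
  rw [lintegral_bern, pow_one, pow_zero, mul_one, ← ENNReal.ofReal_mul hu0,
    ← ENNReal.ofReal_add (by positivity) (by linarith), add_comm]

lemma lintegral_geom_exp {p ξ u : ℝ} (hp0 : 0 < p) (hξ : 0 ≤ ξ) (hpu : p < u) (hu : u < 1) :
    ∫⁻ b, ENNReal.ofReal (Real.exp (-ξ)) ^ b ∂(geom (qpar p u))
      = ENNReal.ofReal (Real.exp (-vLog p ξ u)) := by
  have h1 : Real.exp (-ξ) ≤ 1 := Real.exp_le_one_iff.2 (by linarith)
  have hg := vLog_arg_ge_one hp0 hξ hpu hu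
  rw [lintegral_geom_pow (qpar_nonneg hp0 hpu hu) (qpar_lt_one hp0 hpu hu) (Real.exp_pos _).le h1,
    vLog, Real.exp_neg (Real.log _), Real.exp_log (by linarith), inv_div]
  congr 1
  have e1 : u ≠ 0 := by linarith
  have e2 : 1 - p ≠ 0 := by linarith
  have hup : 0 < u - p := by linarith
  have e3 : u * (1 - p + p * Real.exp (-ξ)) - p * Real.exp (-ξ) ≠ 0 := by
    rw [le_div_iff₀ hup] at hg
    linarith
  have e4 : 1 - qpar p u * Real.exp (-ξ)
      = (u * (1 - p + p * Real.exp (-ξ)) - p * Real.exp (-ξ)) / (u * (1 - p)) := by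
    rw [qpar]; field_simp; ring
  have e5 : 1 - qpar p u = (u - p) / (u * (1 - p)) := by
    rw [qpar]; field_simp; ring
  rw [e4, e5, div_div_div_cancel_right₀ (mul_ne_zero e1 e2)]

section Moment

variable {p ξ : ℝ}

lemma one_le_exp_ofReal (hξ : 0 ≤ ξ) : 1 ≤ ENNReal.ofReal (Real.exp ξ) := by
  rw [← ENNReal.ofReal_one]
  exact ENNReal.ofReal_le_ofReal (Real.one_le_exp hξ)

lemma ofReal_exp_mul_neg (ξ : ℝ) :
    ENNReal.ofReal (Real.exp ξ) * ENNReal.ofReal (Real.exp (-ξ)) = 1 := by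
  rw [← ENNReal.ofReal_mul (Real.exp_pos _).le, ← Real.exp_add]
  simp

lemma exp_pow_mul_expMoment_le (hp0 : 0 < p) (hξ : 0 ≤ ξ) {u : ℝ} (hpu : p < u) (hu : u < 1)
    (m n : ℕ) :
    ENNReal.ofReal (Real.exp (-vLog p ξ u)) ^ n *
        expMoment (bern p) (ENNReal.ofReal (Real.exp ξ)) m n
      ≤ ENNReal.ofReal (1 - u + u * Real.exp ξ) ^ m := by
  have := isProbabilityMeasure_bern hp0.le (by linarith : p ≤ 1)
  have := isProbabilityMeasure_bern (by linarith : 0 ≤ u) hu.le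
  have := isProbabilityMeasure_geom (qpar_nonneg hp0 hpu hu) (qpar_lt_one hp0 hpu hu)
  rw [← lintegral_geom_exp hp0 hξ hpu hu, ← lintegral_bern_exp (by linarith) hu.le]
  exact expMoment_mul_le (isBurke_bern_geom hp0 hpu hu) (one_le_exp_ofReal hξ)
    (ofReal_exp_mul_neg ξ) m n

lemma expMoment_ne_top (hp0 : 0 < p) (hp1 : p < 1) (hξ : 0 ≤ ξ) (m n : ℕ) :
    expMoment (bern p) (ENNReal.ofReal (Real.exp ξ)) m n ≠ ⊤ := by
  obtain ⟨u, hpu, hu⟩ := exists_between hp1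
  intro h
  have h1 := exp_pow_mul_expMoment_le hp0 hξ hpu hu m n
  rw [h, ENNReal.mul_top (pow_ne_zero _ (by simp [Real.exp_pos]))] at h1
  exact (ENNReal.pow_lt_top (n := m) ENNReal.ofReal_lt_top).ne (top_le_iff.1 h1)

lemma expMoment_mono (hξ : 0 ≤ ξ) {m m' n n' : ℕ} (hm : m ≤ m') (hn : n ≤ n') :
    expMoment (bern p) (ENNReal.ofReal (Real.exp ξ)) m n
      ≤ expMoment (bern p) (ENNReal.ofReal (Real.exp ξ)) m' n' :=
  lintegral_mono fun w => pow_le_pow_right₀ (one_le_exp_ofReal hξ) (lpp_mono w hm hn)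

lemma one_le_expMoment (hp0 : 0 < p) (hp1 : p < 1) (hξ : 0 ≤ ξ) (m n : ℕ) :
    1 ≤ expMoment (bern p) (ENNReal.ofReal (Real.exp ξ)) m n := by
  have := isProbabilityMeasure_bern hp0.le hp1.le
  have h := expMoment_mono (p := p) hξ (Nat.zero_le m) (le_refl n)
  refine le_trans ?_ h
  simp [expMoment]

lemma ofReal_exp_logMoment (hp0 : 0 < p) (hp1 : p < 1) (hξ : 0 ≤ ξ) (m n : ℕ) :
    ENNReal.ofReal (Real.exp (logMoment p ξ m n))
      = expMoment (bern p) (ENNReal.ofReal (Real.exp ξ)) m (n + 1) := by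
  have h1 := one_le_expMoment hp0 hp1 hξ m (n + 1)
  have h2 := expMoment_ne_top hp0 hp1 hξ m (n + 1)
  rw [logMoment, Real.exp_log (ENNReal.toReal_pos (by positivity) h2), ENNReal.ofReal_toReal h2]

lemma logMoment_mono (hp0 : 0 < p) (hp1 : p < 1) (hξ : 0 ≤ ξ) {m m' n n' : ℕ} (hm : m ≤ m')
    (hn : n ≤ n') : logMoment p ξ m n ≤ logMoment p ξ m' n' := by
  have h : expMoment (bern p) (ENNReal.ofReal (Real.exp ξ)) m (n + 1)
      ≤ expMoment (bern p) (ENNReal.ofReal (Real.exp ξ)) m' (n' + 1) :=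
    expMoment_mono hξ hm (Nat.succ_le_succ hn)
  rw [← ofReal_exp_logMoment hp0 hp1 hξ, ← ofReal_exp_logMoment hp0 hp1 hξ,
    ENNReal.ofReal_le_ofReal_iff (Real.exp_pos _).le] at h
  exact Real.exp_le_exp.1 h

lemma logMoment_nonneg (hp0 : 0 < p) (hp1 : p < 1) (hξ : 0 ≤ ξ) (m n : ℕ) :
    0 ≤ logMoment p ξ m n := by
  have h := one_le_expMoment hp0 hp1 hξ m (n + 1)
  rw [← ofReal_exp_logMoment hp0 hp1 hξ, ENNReal.one_le_ofReal] at h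
  exact Real.one_le_exp_iff.1 h

lemma ofReal_hLog_pow {u : ℝ} (hξ : 0 ≤ ξ) (hu : 0 ≤ u) (m : ℕ) :
    ENNReal.ofReal (1 - u + u * Real.exp ξ) ^ m = ENNReal.ofReal (Real.exp (m * hLog ξ u)) := by
  have h := hLog_arg_ge_one hξ hu
  rw [← ENNReal.ofReal_pow (by linarith), hLog, Real.exp_nat_mul, Real.exp_log (by linarith)]

lemma ofReal_exp_pow (c : ℝ) (n : ℕ) :
    ENNReal.ofReal (Real.exp c) ^ n = ENNReal.ofReal (Real.exp (n * c)) := by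
  rw [← ENNReal.ofReal_pow (Real.exp_pos _).le, Real.exp_nat_mul]

/-- The upper bound for the logarithmic moment generating function, one for each parameter of the
stationary model. -/
lemma logMoment_le (hp0 : 0 < p) (hp1 : p < 1) (hξ : 0 ≤ ξ) {u : ℝ} (hpu : p < u) (hu : u < 1)
    (m n : ℕ) : logMoment p ξ m n ≤ m * hLog ξ u + (n + 1) * vLog p ξ u := by
  have h := exp_pow_mul_expMoment_le hp0 hξ hpu hu m (n + 1)
  rw [← ofReal_exp_logMoment hp0 hp1 hξ, ofReal_hLog_pow hξ (by linarith), ofReal_exp_pow,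
    ← ENNReal.ofReal_mul (Real.exp_pos _).le, ← Real.exp_add,
    ENNReal.ofReal_le_ofReal_iff (Real.exp_pos _).le, Real.exp_le_exp] at h
  push_cast at h
  linarith

/-- The upper bound is attained, up to a logarithmic error, at some endpoint on the top or the right
side of any given rectangle. -/
lemma exists_le_logMoment (hp0 : 0 < p) (hp1 : p < 1) (hξ : 0 ≤ ξ) {u : ℝ} (hpu : p < u)
    (hu : u < 1) (m n : ℕ) :
    ∃ m' n' : ℕ, ((m' = m ∧ n' ≤ n) ∨ (m' ≤ m ∧ n' = n)) ∧
      m' * hLog ξ u + n' * vLog p ξ u - Real.log (m + n + 2) ≤ logMoment p ξ m' n' := by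
  have := isProbabilityMeasure_bern hp0.le (by linarith : p ≤ 1)
  have := isProbabilityMeasure_bern (by linarith : 0 ≤ u) hu.le
  have := isProbabilityMeasure_geom (qpar_nonneg hp0 hpu hu) (qpar_lt_one hp0 hpu hu)
  have h := le_sum_exit (isBurke_bern_geom hp0 hpu hu) (one_le_exp_ofReal hξ)
    (ofReal_exp_mul_neg ξ) m (n + 1)
  rw [lintegral_geom_exp hp0 hξ hpu hu, lintegral_bern_exp (by linarith) hu.le] at h
  have hv := vLog_nonneg hp0 hξ hpu hu
  have hC : (0 : ℝ) < m + n + 2 := by positivity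
  by_contra! hcon
  -- If no endpoint works, each exit term is below the average `α ^ m / (m + n + 2)`.
  have hS : ∀ k ∈ Finset.range (m + 1), ENNReal.ofReal (1 - u + u * Real.exp ξ) ^ k *
      (ENNReal.ofReal (Real.exp (-vLog p ξ u)) ^ (n + 1) *
        expMoment (bern p) (ENNReal.ofReal (Real.exp ξ)) (m - k) (n + 1))
      < ENNReal.ofReal (Real.exp (m * hLog ξ u - Real.log (m + n + 2))) := by
    intro k hk
    have hk : k ≤ m := Nat.lt_succ_iff.1 (Finset.mem_range.1 hk)
    have h1 := hcon (m - k) n (Or.inr ⟨by omega, rfl⟩)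
    rw [← ofReal_exp_logMoment hp0 hp1 hξ, ofReal_hLog_pow hξ (by linarith), ofReal_exp_pow,
      ← ENNReal.ofReal_mul (Real.exp_pos _).le, ← ENNReal.ofReal_mul (Real.exp_pos _).le,
      ← Real.exp_add, ← Real.exp_add, ENNReal.ofReal_lt_ofReal_iff (Real.exp_pos _),
      Real.exp_lt_exp]
    push_cast [Nat.cast_sub hk] at h1 ⊢
    linarith
  have hW : ∀ l ∈ Finset.range (n + 1),
      ENNReal.ofReal (Real.exp (-vLog p ξ u)) ^ (n + 1 - (l + 1)) *
        expMoment (bern p) (ENNReal.ofReal (Real.exp ξ)) m (n + 1 - l)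
      < ENNReal.ofReal (Real.exp (m * hLog ξ u - Real.log (m + n + 2))) := by
    intro l hl
    have hl : l ≤ n := Nat.lt_succ_iff.1 (Finset.mem_range.1 hl)
    have h1 := hcon m (n - l) (Or.inl ⟨rfl, by omega⟩)
    rw [show n + 1 - (l + 1) = n - l by omega, show n + 1 - l = n - l + 1 by omega,
      ← ofReal_exp_logMoment hp0 hp1 hξ, ofReal_exp_pow,
      ← ENNReal.ofReal_mul (Real.exp_pos _).le,
      ← Real.exp_add, ENNReal.ofReal_lt_ofReal_iff (Real.exp_pos _), Real.exp_lt_exp]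
    linarith
  have hlt := ENNReal.add_lt_add
    (ENNReal.sum_lt_sum_of_nonempty (by simp) hS) (ENNReal.sum_lt_sum_of_nonempty (by simp) hW)
  have htot : ENNReal.ofReal (1 - u + u * Real.exp ξ) ^ m
      = ∑ k ∈ Finset.range (m + 1),
          ENNReal.ofReal (Real.exp (m * hLog ξ u - Real.log (m + n + 2))) +
        ∑ l ∈ Finset.range (n + 1),
          ENNReal.ofReal (Real.exp (m * hLog ξ u - Real.log (m + n + 2))) := by
    rw [Finset.sum_const, Finset.sum_const, Finset.card_range, Finset.card_range, ← add_nsmul,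
      nsmul_eq_mul, ← ENNReal.ofReal_natCast, ← ENNReal.ofReal_mul (by positivity), Real.exp_sub,
      Real.exp_log hC, ofReal_hLog_pow hξ (by linarith)]
    congr 1
    push_cast
    field_simp
    ring
  rw [htot] at h
  exact absurd (h.trans_lt hlt) (lt_irrefl _)

/-- The straight path along the bottom row collects a binomial weight. -/
lemma mul_hLog_le_logMoment (hp0 : 0 < p) (hp1 : p < 1) (hξ : 0 ≤ ξ) (m n : ℕ) :
    m * hLog ξ p ≤ logMoment p ξ m n := by
  have := isProbabilityMeasure_bern hp0.le hp1.le
  refine le_trans ?_ (logMoment_mono hp0 hp1 hξ le_rfl (Nat.zero_le n))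
  have h := lintegral_infinitePi_prod_mul (fun _ : ℕ × ℕ => bern p)
    (e := fun i => (i + 1, 0)) (fun i k h => by simpa using h) (Finset.range m)
    (fun _ k => ENNReal.ofReal (Real.exp ξ) ^ k) (Q := fun _ => 1) measurable_const
    (fun _ _ _ => rfl)
  have hlpp : ∀ w : ℕ × ℕ → ℕ, lpp w m 1 = ∑ i ∈ Finset.range m, w (i + 1, 0) := by
    intro w
    clear h
    induction m with
    | zero => simp
    | succ m ih => rw [lpp_succ_succ, lpp_zero_right, ih, Finset.sum_range_succ]; simp
  simp only [mul_one, lintegral_const, measure_univ, Finset.prod_pow_eq_pow_sum, ← hlpp,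
    Finset.prod_const, Finset.card_range, lintegral_bern_exp hp0.le hp1.le] at h
  have h' : expMoment (bern p) (ENNReal.ofReal (Real.exp ξ)) m (0 + 1)
      = ENNReal.ofReal (1 - p + p * Real.exp ξ) ^ m := h
  rw [← ofReal_exp_logMoment hp0 hp1 hξ, ofReal_hLog_pow hξ hp0.le] at h'
  have h2 := (ENNReal.ofReal_le_ofReal_iff (Real.exp_pos _).le).1 h'.ge
  exact Real.exp_le_exp.1 h2

lemma IsBernoulliEnv.logMoment_le_mul {Ω : Type*} [MeasurableSpace Ω] {μ : Measure Ω}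
    {ω : ℕ × ℕ → Ω → ℕ} (hp0 : 0 < p) (hp1 : p < 1) (hω : IsBernoulliEnv μ p ω) (hξ : 0 ≤ ξ)
    (m n : ℕ) : logMoment p ξ m n ≤ m * ξ := by
  have := hω.isProbabilityMeasure
  have h : expMoment (bern p) (ENNReal.ofReal (Real.exp ξ)) m (n + 1)
      ≤ ENNReal.ofReal (Real.exp ξ) ^ m := by
    rw [← hω.lintegral_lastPassage hp0 hp1]
    calc _ ≤ ∫⁻ _, ENNReal.ofReal (Real.exp ξ) ^ m ∂μ := by
          refine lintegral_mono_ae ?_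
          filter_upwards [hω.ae_le_one hp0 hp1] with x hx
          rw [lastPassage_eq_lpp]
          exact pow_le_pow_right₀ (one_le_exp_ofReal hξ) (lpp_le_of_weights_le_one hx _ _)
      _ = _ := by simp
  rw [← ofReal_exp_logMoment hp0 hp1 hξ, ofReal_exp_pow,
    ENNReal.ofReal_le_ofReal_iff (Real.exp_pos _).le] at h
  exact Real.exp_le_exp.1 h

end Moment

/-! ### The characteristic direction -/

lemma eventually_add_log_le (s t C : ℝ) (hs : 0 ≤ s) (ht : 0 ≤ t) {ε : ℝ} (hε : 0 < ε) :
    ∀ᶠ N : ℕ in atTop,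
      C + Real.log ((⌊(N : ℝ) * s⌋₊ : ℝ) + (⌊(N : ℝ) * t⌋₊ : ℝ) + 2) ≤ ε * N := by
  have h1 : Tendsto (fun N : ℕ => Real.log (N : ℝ) / (N : ℝ)) atTop (𝓝 0) := by
    have h := Real.isLittleO_log_id_atTop.tendsto_div_nhds_zero
    exact h.comp tendsto_natCast_atTop_atTop
  have h2 : Tendsto (fun N : ℕ => (C + Real.log (s + t + 2)) / (N : ℝ)) atTop (𝓝 0) :=
    tendsto_const_nhds.div_atTop tendsto_natCast_atTop_atTop
  have h3 := (h1.add h2).eventually (gt_mem_nhds (by simpa using hε))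
  filter_upwards [h3, eventually_ge_atTop 1] with N hN hN1
  have hNpos : (0 : ℝ) < N := by exact_mod_cast hN1
  have hN1' : (1 : ℝ) ≤ N := by exact_mod_cast hN1
  have hle : (⌊(N : ℝ) * s⌋₊ : ℝ) + (⌊(N : ℝ) * t⌋₊ : ℝ) + 2 ≤ N * (s + t + 2) := by
    have e1 := Nat.floor_le (mul_nonneg hNpos.le hs)
    have e2 := Nat.floor_le (mul_nonneg hNpos.le ht)
    nlinarith
  have hlog := Real.log_le_log (by positivity) hle
  rw [Real.log_mul hNpos.ne' (by positivity)] at hlog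
  rw [← add_div, div_lt_iff₀ hNpos] at hN
  linarith

lemma eventually_lt_of_hasDerivAt_pos {f : ℝ → ℝ} {f' x : ℝ} (hf : HasDerivAt f f' x)
    (hf' : 0 < f') : (∀ᶠ u in 𝓝[<] x, f u < f x) ∧ ∀ᶠ u in 𝓝[>] x, f x < f u := by
  have h := (hasDerivAt_iff_tendsto_slope.1 hf).eventually (lt_mem_nhds hf')
  constructor
  · have h1 := h.filter_mono (nhdsWithin_mono x fun u (hu : u < x) => hu.ne)
    filter_upwards [h1, self_mem_nhdsWithin] with u hu hux
    have hux : u < x := hux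
    rw [slope_def_field, div_pos_iff] at hu
    rcases hu with hu | hu <;> linarith
  · have h1 := h.filter_mono (nhdsWithin_mono x fun u (hu : x < u) => hu.ne')
    filter_upwards [h1, self_mem_nhdsWithin] with u hu hux
    have hux : x < u := hux
    rw [slope_def_field, div_pos_iff] at hu
    rcases hu with hu | hu <;> linarith

lemma neg_mul_le_abs (x : ℝ) {d : ℝ} (hd0 : 0 ≤ d) (hd1 : d ≤ 1) : -(d * x) ≤ |x| := by
  rcases abs_cases x with ⟨h, hx⟩ | ⟨h, hx⟩ <;> rw [h] <;> nlinarith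

/-- If `(s, t)` is a critical direction for the parameter `u`, that is `s L'(u) + t g'(u) = 0` for
`L = hLog ξ`, `g = vLog p ξ`, then the upper bound with parameter `u` is asymptotically attained in
the direction `(s, t)`. The endpoint on the boundary of the rectangle at which it is almost attained
must be close to the corner, because elsewhere a parameter slightly smaller or larger than `u` gives
a better upper bound. -/
lemma eventually_le_logMoment_of_critical {p ξ : ℝ} (hp0 : 0 < p) (hp1 : p < 1) (hξ : 0 ≤ ξ)
    {u : ℝ} (hpu : p < u) (hu : u < 1) {s t a b : ℝ} (hs : 0 < s) (ht : 0 < t) (ha : 0 < a)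
    (hb : 0 < b) (hL : HasDerivAt (hLog ξ) a u) (hg : HasDerivAt (vLog p ξ) (-b) u)
    (hcrit : s * a = t * b) {ε : ℝ} (hε : 0 < ε) :
    ∀ᶠ N : ℕ in atTop, N * (s * hLog ξ u + t * vLog p ξ u - ε)
      ≤ logMoment p ξ ⌊(N : ℝ) * s⌋₊ ⌊(N : ℝ) * t⌋₊ := by
  set L := hLog ξ with hLdef
  set g := vLog p ξ with hgdef
  have hLu : 0 ≤ L u := hLog_nonneg hξ (by linarith)
  have hgu : 0 ≤ g u := vLog_nonneg hp0 hξ hpu hu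
  obtain ⟨δ, hδ, hδε⟩ : ∃ δ : ℝ, 0 < δ ∧ 2 * δ * (L u + g u) ≤ ε / 2 := by
    refine ⟨ε / (4 * (L u + g u + 1)), by positivity, ?_⟩
    have hpos : 0 < L u + g u + 1 := by linarith
    have e : 2 * (ε / (4 * (L u + g u + 1))) * (L u + g u)
        = ε / 2 * ((L u + g u) / (L u + g u + 1)) := by field_simp; ring
    rw [e]
    have : (L u + g u) / (L u + g u + 1) ≤ 1 := (div_le_one hpos).2 (by linarith)
    nlinarith
  -- a parameter below `u` that penalizes endpoints on the right side
  obtain ⟨u₁, ⟨hu₁p, hu₁⟩, h1, hg1⟩ : ∃ u₁, (p < u₁ ∧ u₁ < u) ∧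
      s * (L u₁ - L u) + t * (g u₁ - g u) < δ * (g u₁ - g u) ∧ g u < g u₁ := by
    have hd : HasDerivAt (fun v => s * L v + (t - δ) * g v) (s * a + (t - δ) * (-b)) u :=
      (hL.const_mul s).add (hg.const_mul (t - δ))
    have e1 := (eventually_lt_of_hasDerivAt_pos hd (by nlinarith)).1
    have e2 := (eventually_lt_of_hasDerivAt_pos hg.neg (by linarith)).1
    have e3 : ∀ᶠ v in 𝓝[<] u, p < v ∧ v < u := by
      filter_upwards [nhdsWithin_le_nhds (lt_mem_nhds hpu), self_mem_nhdsWithin] with v hv hv'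
      exact ⟨hv, hv'⟩
    obtain ⟨v, hv1, hv2, hv3⟩ := (e1.and (e2.and e3)).exists
    simp only [Pi.neg_apply] at hv2
    exact ⟨v, hv3, by linarith, by linarith⟩
  -- a parameter above `u` that penalizes endpoints on the top side
  obtain ⟨u₂, ⟨hu₂, hu₂1⟩, h2, hL2⟩ : ∃ u₂, (u < u₂ ∧ u₂ < 1) ∧
      s * (L u₂ - L u) + t * (g u₂ - g u) < δ * (L u₂ - L u) ∧ L u < L u₂ := by
    have hd : HasDerivAt (fun v => -((s - δ) * L v + t * g v)) (-((s - δ) * a + t * (-b))) u :=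
      ((hL.const_mul (s - δ)).add (hg.const_mul t)).neg
    have e1 := (eventually_lt_of_hasDerivAt_pos hd (by nlinarith)).2
    have e2 := (eventually_lt_of_hasDerivAt_pos hL ha).2
    have e3 : ∀ᶠ v in 𝓝[>] u, u < v ∧ v < 1 := by
      filter_upwards [nhdsWithin_le_nhds (gt_mem_nhds hu), self_mem_nhdsWithin] with v hv hv'
      exact ⟨hv', hv⟩
    obtain ⟨v, hv1, hv2, hv3⟩ := (e1.and (e2.and e3)).exists
    exact ⟨v, hv3, by linarith, by linarith⟩
  filter_upwards [eventually_add_log_le s t (|L u₁ - L u| + g u₁) hs.le ht.le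
      (mul_pos hδ (sub_pos.2 hg1)),
    eventually_add_log_le s t (|g u₂ - g u| + g u₂) hs.le ht.le (mul_pos hδ (sub_pos.2 hL2)),
    eventually_add_log_le s t (L u + g u) hs.le ht.le (half_pos hε)] with N hN1 hN2 hN3
  set m := ⌊(N : ℝ) * s⌋₊ with hm
  set n := ⌊(N : ℝ) * t⌋₊ with hn
  have hN0 : (0 : ℝ) ≤ N := N.cast_nonneg
  have hm1 : (m : ℝ) ≤ N * s := Nat.floor_le (by positivity)
  have hn1 : (n : ℝ) ≤ N * t := Nat.floor_le (by positivity)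
  have hm2 : (N : ℝ) * s < m + 1 := Nat.lt_floor_add_one _
  have hn2 : (N : ℝ) * t < n + 1 := Nat.lt_floor_add_one _
  have hNδ : 0 ≤ (N : ℝ) * δ := by positivity
  have hNδε : (N : ℝ) * (2 * δ * (L u + g u)) ≤ N * (ε / 2) :=
    mul_le_mul_of_nonneg_left hδε hN0
  obtain ⟨m', n', hmn, hlow⟩ := exists_le_logMoment hp0 hp1 hξ hpu hu m n
  rw [← hLdef, ← hgdef] at hlow
  rcases hmn with ⟨rfl, hn'⟩ | ⟨hm', rfl⟩
  · have hmono := logMoment_mono hp0 hp1 hξ (le_refl m) hn'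
    have hup := logMoment_le hp0 hp1 hξ hu₁p (hu₁.trans hu) m n'
    rw [← hLdef, ← hgdef] at hup
    have ha1 : (m : ℝ) * (L u₁ - L u) ≤ N * s * (L u₁ - L u) + |L u₁ - L u| := by
      linarith [neg_mul_le_abs (L u₁ - L u) (sub_nonneg.2 hm1) (by linarith)]
    have ha2 := mul_le_mul_of_nonneg_left h1.le hN0
    have ha3 : (N * t - n') * (g u₁ - g u) ≤ 2 * δ * N * (g u₁ - g u) := by linarith
    have hk : N * t - n' ≤ 2 * δ * N := le_of_mul_le_mul_right ha3 (by linarith)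
    have hk' := mul_le_mul_of_nonneg_right hk hgu
    have hm3 := mul_le_mul_of_nonneg_right hm2.le hLu
    linarith [mul_nonneg hNδ hLu]
  · have hmono := logMoment_mono hp0 hp1 hξ hm' (le_refl n)
    have hup := logMoment_le hp0 hp1 hξ (hpu.trans hu₂) hu₂1 m' n
    rw [← hLdef, ← hgdef] at hup
    have ha1 : (n : ℝ) * (g u₂ - g u) ≤ N * t * (g u₂ - g u) + |g u₂ - g u| := by
      linarith [neg_mul_le_abs (g u₂ - g u) (sub_nonneg.2 hn1) (by linarith)]
    have ha2 := mul_le_mul_of_nonneg_left h2.le hN0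
    have ha3 : (N * s - m') * (L u₂ - L u) ≤ 2 * δ * N * (L u₂ - L u) := by linarith
    have hk : N * s - m' ≤ 2 * δ * N := le_of_mul_le_mul_right ha3 (by linarith)
    have hk' := mul_le_mul_of_nonneg_right hk hLu
    have hn3 := mul_le_mul_of_nonneg_right hn2.le hgu
    linarith [mul_nonneg hNδ hgu]

lemma hasDerivAt_hLog {ξ u : ℝ} (hξ : 0 ≤ ξ) (hu : 0 ≤ u) :
    HasDerivAt (hLog ξ) ((Real.exp ξ - 1) / (1 - u + u * Real.exp ξ)) u := by
  have h1 : HasDerivAt (fun v : ℝ => 1 - v + v * Real.exp ξ) (-1 + 1 * Real.exp ξ) u :=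
    ((hasDerivAt_id u).const_sub 1).add ((hasDerivAt_id u).mul_const _)
  have h : HasDerivAt (hLog ξ) _ u := h1.log (by linarith [hLog_arg_ge_one hξ hu])
  convert h using 2
  ring

lemma hasDerivAt_vLog {p ξ u : ℝ} (hp0 : 0 < p) (hξ : 0 ≤ ξ) (hpu : p < u)
    (hu : u < 1) :
    HasDerivAt (vLog p ξ) (-(p * (1 - p) * (1 - Real.exp (-ξ)) /
      ((u * (1 - p + p * Real.exp (-ξ)) - p * Real.exp (-ξ)) * (u - p)))) u := by
  set y := Real.exp (-ξ)
  have hup : 0 < u - p := by linarith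
  have hpos : 0 < u * (1 - p + p * y) - p * y := by
    have h := vLog_arg_ge_one hp0 hξ hpu hu
    rw [le_div_iff₀ hup] at h
    linarith
  have h1 : HasDerivAt (fun v : ℝ => v * (1 - p + p * y) - p * y) (1 * (1 - p + p * y)) u :=
    ((hasDerivAt_id u).mul_const _).sub_const _
  have h2 : HasDerivAt (fun v : ℝ => v - p) 1 u := (hasDerivAt_id u).sub_const _
  have h : HasDerivAt (vLog p ξ) _ u := (h1.fun_div h2 hup.ne').log (div_pos hpos hup).ne'
  convert h using 1
  field_simp
  ring

/-- The critical directions, with cleared denominators. -/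
lemma eventually_le_logMoment {p ξ : ℝ} (hp0 : 0 < p) (hp1 : p < 1) (hξ : 0 < ξ) {u : ℝ}
    (hpu : p < u) (hu : u < 1) {s t : ℝ} (hs : 0 < s) (ht : 0 < t)
    (hcrit : s * ((u * (1 - p + p * Real.exp (-ξ)) - p * Real.exp (-ξ)) * (u - p)) * Real.exp ξ
      = t * (p * (1 - p)) * (1 - u + u * Real.exp ξ)) {ε : ℝ} (hε : 0 < ε) :
    ∀ᶠ N : ℕ in atTop, N * (s * hLog ξ u + t * vLog p ξ u - ε)
      ≤ logMoment p ξ ⌊(N : ℝ) * s⌋₊ ⌊(N : ℝ) * t⌋₊ := by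
  have hE : 1 < Real.exp ξ := Real.one_lt_exp_iff.2 hξ
  have hy : Real.exp (-ξ) < 1 := Real.exp_lt_one_iff.2 (by linarith)
  have hEy : Real.exp ξ * Real.exp (-ξ) = 1 := by rw [← Real.exp_add]; simp
  have hL := hLog_arg_ge_one hξ.le (by linarith : 0 ≤ u)
  have hup : 0 < u - p := by linarith
  have hpos : 0 < u * (1 - p + p * Real.exp (-ξ)) - p * Real.exp (-ξ) := by
    have h := vLog_arg_ge_one hp0 hξ.le hpu hu
    rw [le_div_iff₀ hup] at h
    linarith
  refine eventually_le_logMoment_of_critical hp0 hp1 hξ.le hpu hu hs ht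
    (div_pos (by linarith) (by linarith))
    (div_pos (mul_pos (mul_pos hp0 (by linarith)) (by linarith)) (mul_pos hpos hup))
    (hasDerivAt_hLog hξ.le (by linarith)) (hasDerivAt_vLog hp0 hξ.le hpu hu) ?_ hε
  rw [← mul_div_assoc, ← mul_div_assoc, div_eq_div_iff (by linarith) (mul_pos hpos hup).ne']
  have hE1 : Real.exp ξ - 1 = Real.exp ξ * (1 - Real.exp (-ξ)) := by rw [mul_sub, hEy]; ring
  rw [hE1]
  linear_combination (1 - Real.exp (-ξ)) * hcrit

/-! ### Existence of the rate function -/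

lemma apply_mul_add_le_of_subadditive_ge {a : ℕ → ℝ} {K : ℕ}
    (ha : ∀ m n, K ≤ m → K ≤ n → a (m + n) ≤ a m + a n) (k : ℕ) {n r : ℕ} (hn : K ≤ n)
    (hr : K ≤ r) : a (k * n + r) ≤ k * a n + a r := by
  induction k with
  | zero => simp
  | succ k ih =>
    have h := ha n (k * n + r) hn (by omega)
    rw [show (k + 1) * n + r = n + (k * n + r) by ring]
    push_cast
    linarith

/-- Fekete's lemma for a nonnegative sequence that is only subadditive on indices `≥ K`. -/
lemma exists_tendsto_div_of_subadditive_ge {a : ℕ → ℝ} {K : ℕ} (h0 : ∀ n, 0 ≤ a n)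
    (ha : ∀ m n, K ≤ m → K ≤ n → a (m + n) ≤ a m + a n) :
    ∃ l, Tendsto (fun n => a n / n) atTop (𝓝 l) := by
  set S := (fun n : ℕ => a n / n) '' Set.Ici (K + 1) with hS
  have hbdd : BddBelow S :=
    ⟨0, by rintro _ ⟨n, -, rfl⟩; exact div_nonneg (h0 n) n.cast_nonneg⟩
  refine ⟨sInf S, tendsto_order.2 ⟨fun l hl => ?_, fun L hL => ?_⟩⟩
  · filter_upwards [eventually_ge_atTop (K + 1)] with n hn
    exact hl.trans_le (csInf_le hbdd ⟨n, hn, rfl⟩)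
  · obtain ⟨_, ⟨n, hn, rfl⟩, hnL⟩ :=
      exists_lt_of_csInf_lt (Set.Nonempty.image _ Set.nonempty_Ici) hL
    have hn : K + 1 ≤ n := hn
    have hn0 : n ≠ 0 := by omega
    have hn0' : (n : ℝ) ≠ 0 := by exact_mod_cast hn0
    refine .atTop_of_arithmetic hn0 fun r _ => ?_
    have A : Tendsto (fun x : ℝ => (a n + a (n + r) / x) / (n + ((n + r : ℕ) : ℝ) / x)) atTop
        (𝓝 ((a n + 0) / (n + 0))) :=
      (tendsto_const_nhds.add <| tendsto_const_nhds.div_atTop tendsto_id).div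
        (tendsto_const_nhds.add <| tendsto_const_nhds.div_atTop tendsto_id) (by simpa)
    have B : Tendsto (fun x : ℝ => (x * a n + a (n + r)) / (x * n + ((n + r : ℕ) : ℝ))) atTop
        (𝓝 (a n / n)) := by
      rw [add_zero, add_zero] at A
      refine A.congr' <| (eventually_ne_atTop 0).mono fun x hx => ?_
      simp only [add_div' _ _ _ hx, div_div_div_cancel_right₀ hx, mul_comm]
    have C := (B.comp tendsto_natCast_atTop_atTop).eventually (gt_mem_nhds hnL)
    obtain ⟨k₀, hk₀⟩ := eventually_atTop.1 C
    refine eventually_atTop.2 ⟨k₀ + 1, fun k hk => ?_⟩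
    obtain ⟨k, rfl⟩ : ∃ k', k = k' + 1 := ⟨k - 1, by omega⟩
    have hk1 := hk₀ k (by omega)
    have hidx : n * (k + 1) + r = k * n + (n + r) := by ring
    rw [hidx]
    refine lt_of_le_of_lt ?_ hk1
    simp only [Function.comp_apply]
    have e := apply_mul_add_le_of_subadditive_ge ha k (n := n) (r := n + r) (by omega) (by omega)
    push_cast at e ⊢
    gcongr

section Env

variable {Ω : Type*} [MeasurableSpace Ω] {μ : Measure Ω} {p : ℝ} {ω : ℕ × ℕ → Ω → ℕ}

lemma IsBernoulliEnv.shift (hω : IsBernoulliEnv μ p ω) (c : ℕ × ℕ) :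
    IsBernoulliEnv μ p fun v => ω (c + v) where
  measurable _ := hω.measurable _
  indep := hω.indep.precomp (shiftEnv_add_injective c)
  prob_one _ := hω.prob_one _
  prob_zero _ := hω.prob_zero _

lemma measurableSet_le_lpp (b : ℝ) (m n : ℕ) :
    MeasurableSet {w : ℕ × ℕ → ℕ | b ≤ (lpp w m n : ℝ)} :=
  (measurable_lpp m n) (MeasurableSet.of_discrete (s := {k : ℕ | b ≤ (k : ℝ)}))

lemma IsBernoulliEnv.measure_le_lpp_shift (hp0 : 0 < p) (hp1 : p < 1) (hω : IsBernoulliEnv μ p ω)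
    (c : ℕ × ℕ) (b : ℝ) (m n : ℕ) :
    μ {x | b ≤ (lpp (shiftEnv c fun v => ω v x) m n : ℝ)}
      = μ {x | b ≤ (lpp (fun v => ω v x) m n : ℝ)} := by
  have h1 := (hω.shift c).map_eq hp0 hp1
  rw [← hω.map_eq hp0 hp1] at h1
  have h2 := congrArg (fun ρ => ρ {w : ℕ × ℕ → ℕ | b ≤ (lpp w m n : ℝ)}) h1
  rw [Measure.map_apply (hω.shift c).measurable_env (measurableSet_le_lpp b m n),
    Measure.map_apply hω.measurable_env (measurableSet_le_lpp b m n)] at h2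
  exact h2

/-- The environment that agrees with `y` on `S` and vanishes elsewhere. -/
def extendZero (S : Finset (ℕ × ℕ)) (y : S → ℕ) : ℕ × ℕ → ℕ :=
  fun v => if h : v ∈ S then y ⟨v, h⟩ else 0

lemma measurable_extendZero (S : Finset (ℕ × ℕ)) : Measurable (extendZero S) := by
  refine measurable_pi_iff.2 fun v => ?_
  by_cases h : v ∈ S
  · simpa [extendZero, h] using measurable_pi_apply (⟨v, h⟩ : S)
  · simp [extendZero, h]

/-- Superadditivity of the tail probabilities: the two blocks use disjoint sets of columns. -/
lemma IsBernoulliEnv.measure_le_lpp_mul_le (hp0 : 0 < p) (hp1 : p < 1)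
    (hω : IsBernoulliEnv μ p ω) (a b : ℝ) (m n m' n' : ℕ) :
    μ {x | a ≤ (lpp (fun v => ω v x) m (n + 1) : ℝ)} *
        μ {x | b ≤ (lpp (fun v => ω v x) m' (n' + 1) : ℝ)}
      ≤ μ {x | a + b ≤ (lpp (fun v => ω v x) (m + m') (n + n' + 1) : ℝ)} := by
  rw [← hω.measure_le_lpp_shift hp0 hp1 (m, n) b]
  set S : Finset (ℕ × ℕ) := Finset.Icc 1 m ×ˢ Finset.range (n + 1) with hS
  set T : Finset (ℕ × ℕ) := Finset.Icc (m + 1) (m + m') ×ˢ Finset.range (n + n' + 1) with hT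
  have hd : Disjoint S T := by
    rw [Finset.disjoint_left]
    rintro ⟨i, j⟩ h1 h2
    simp only [hS, hT, Finset.mem_product, Finset.mem_Icc] at h1 h2
    omega
  have hind := hω.indep.indepFun_finset S T hd hω.measurable
  have eS : ∀ x, lpp (extendZero S fun i => ω i x) m (n + 1) = lpp (fun v => ω v x) m (n + 1) := by
    intro x
    refine lpp_congr _ _ fun i j h1 h2 h3 => ?_
    rw [extendZero, dif_pos]
    simp only [hS, Finset.mem_product, Finset.mem_Icc, Finset.mem_range]
    omega
  have eT : ∀ x, lpp (shiftEnv (m, n) (extendZero T fun i => ω i x)) m' (n' + 1)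
      = lpp (shiftEnv (m, n) fun v => ω v x) m' (n' + 1) := by
    intro x
    refine lpp_congr _ _ fun i j h1 h2 h3 => ?_
    rw [shiftEnv, shiftEnv, extendZero, dif_pos]
    simp only [hT, Finset.mem_product, Finset.mem_Icc, Finset.mem_range, Prod.mk_add_mk]
    omega
  have hA : MeasurableSet {y : S → ℕ | a ≤ (lpp (extendZero S y) m (n + 1) : ℝ)} :=
    measurable_extendZero S (measurableSet_le_lpp a m (n + 1))
  have hB : MeasurableSet
      {y : T → ℕ | b ≤ (lpp (shiftEnv (m, n) (extendZero T y)) m' (n' + 1) : ℝ)} :=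
    ((measurable_pi_iff.2 fun v => (measurable_pi_apply _).comp (measurable_extendZero T) :
      Measurable fun y => shiftEnv (m, n) (extendZero T y)))
        (measurableSet_le_lpp b m' (n' + 1))
  have h := hind.measure_inter_preimage_eq_mul _ _ hA hB
  simp only [Set.preimage_ofPred_eq, eS, eT] at h
  rw [← h]
  refine measure_mono fun x hx => ?_
  obtain ⟨h1, h2⟩ := hx
  have h3 := lpp_add_shift_le (fun v => ω v x) m n m' n'
  have h1 : a ≤ (lpp (fun v => ω v x) m (n + 1) : ℝ) := h1
  have h2 : b ≤ (lpp (shiftEnv (m, n) fun v => ω v x) m' (n' + 1) : ℝ) := h2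
  have h3' : (lpp (fun v => ω v x) m (n + 1) : ℝ) +
      (lpp (shiftEnv (m, n) fun v => ω v x) m' (n' + 1) : ℝ)
      ≤ (lpp (fun v => ω v x) (m + m') (n + n' + 1) : ℝ) := by exact_mod_cast h3
  exact (add_le_add h1 h2).trans h3'

lemma IsBernoulliEnv.measure_le_lpp_pos (hp0 : 0 < p) (hp1 : p < 1) (hω : IsBernoulliEnv μ p ω)
    (m n : ℕ) : 0 < μ {x | (m : ℝ) ≤ (lpp (fun v => ω v x) m (n + 1) : ℝ)} := by
  have := hω.isProbabilityMeasure
  induction m with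
  | zero => simp
  | succ m ih =>
    have h1 : 0 < μ {x | (1 : ℝ) ≤ (lpp (fun v => ω v x) 1 (0 + 1) : ℝ)} := by
      refine lt_of_lt_of_le ?_ (measure_mono (s := {x | ω (1, 0) x = 1}) fun x hx => ?_)
      · rw [hω.prob_one]; simpa using hp0
      · have hx : ω (1, 0) x = 1 := hx
        have e : lpp (fun v => ω v x) 1 (0 + 1) = 1 := by
          rw [lpp_succ_succ]; simp [hx]
        change (1 : ℝ) ≤ (lpp (fun v => ω v x) 1 (0 + 1) : ℝ)
        rw [e]; simp
    have h := hω.measure_le_lpp_mul_le hp0 hp1 m 1 m n 1 0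
    rw [Nat.cast_succ]
    exact lt_of_lt_of_le (ENNReal.mul_pos ih.ne' h1.ne') h

/-- The event in the definition of the tail exponent. -/
def tailEvent (ω : ℕ × ℕ → Ω → ℕ) (s t r : ℝ) (N : ℕ) : Set Ω :=
  {x | (N : ℝ) * r ≤ (lastPassage (fun v => ω v x) ⌊(N : ℝ) * s⌋₊ ⌊(N : ℝ) * t⌋₊ : ℝ)}

lemma IsBernoulliEnv.measurableSet_tailEvent (hω : IsBernoulliEnv μ p ω) (s t r : ℝ) (N : ℕ) :
    MeasurableSet (tailEvent ω s t r N) := by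
  simp only [tailEvent, lastPassage_eq_lpp]
  exact hω.measurable_env (measurableSet_le_lpp _ _ _)

lemma IsBernoulliEnv.tailEvent_mul_le (hp0 : 0 < p) (hp1 : p < 1) (hω : IsBernoulliEnv μ p ω)
    {s t : ℝ} (hs : 0 ≤ s) (ht : 0 ≤ t) (r : ℝ) (M N : ℕ) :
    μ (tailEvent ω s t r M) * μ (tailEvent ω s t r N) ≤ μ (tailEvent ω s t r (M + N)) := by
  simp only [tailEvent, lastPassage_eq_lpp]
  refine (hω.measure_le_lpp_mul_le hp0 hp1 _ _ _ _ _ _).trans (measure_mono fun x hx => ?_)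
  have hfl : ∀ c : ℝ, 0 ≤ c → ⌊(M : ℝ) * c⌋₊ + ⌊(N : ℝ) * c⌋₊ ≤ ⌊((M + N : ℕ) : ℝ) * c⌋₊ := by
    intro c hc
    refine Nat.le_floor ?_
    push_cast
    have e1 := Nat.floor_le (mul_nonneg (Nat.cast_nonneg (α := ℝ) M) hc)
    have e2 := Nat.floor_le (mul_nonneg (Nat.cast_nonneg (α := ℝ) N) hc)
    linarith
  have hmono := lpp_mono (fun v => ω v x) (hfl s hs) (Nat.succ_le_succ (hfl t ht))
  have hx : (M : ℝ) * r + (N : ℝ) * r ≤ (lpp (fun v => ω v x)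
    (⌊(M : ℝ) * s⌋₊ + ⌊(N : ℝ) * s⌋₊) (⌊(M : ℝ) * t⌋₊ + ⌊(N : ℝ) * t⌋₊ + 1) : ℝ) := hx
  change ((M + N : ℕ) : ℝ) * r ≤ _
  push_cast at hx ⊢
  have hmono' := (Nat.cast_le (α := ℝ)).2 hmono
  push_cast at hmono'
  linarith

lemma IsBernoulliEnv.eventually_tailEvent_pos (hp0 : 0 < p) (hp1 : p < 1)
    (hω : IsBernoulliEnv μ p ω) {s : ℝ} (t : ℝ) {r : ℝ} (hr : r < s) :
    ∀ᶠ N : ℕ in atTop, 0 < μ (tailEvent ω s t r N) := by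
  have h := (tendsto_natCast_atTop_atTop (R := ℝ)).eventually (eventually_ge_atTop (1 / (s - r)))
  filter_upwards [h] with N hN
  refine (hω.measure_le_lpp_pos hp0 hp1 ⌊(N : ℝ) * s⌋₊ ⌊(N : ℝ) * t⌋₊).trans_le
    (measure_mono fun x hx => ?_)
  have hx : (⌊(N : ℝ) * s⌋₊ : ℝ) ≤ (lpp (fun v => ω v x) ⌊(N : ℝ) * s⌋₊
    (⌊(N : ℝ) * t⌋₊ + 1) : ℝ) := hx
  rw [div_le_iff₀ (by linarith)] at hN
  have h1 := Nat.lt_floor_add_one ((N : ℝ) * s)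
  simp only [tailEvent, lastPassage_eq_lpp]
  change (N : ℝ) * r ≤ _
  linarith

lemma tailExponent_eq_coe [IsProbabilityMeasure μ] {s t r : ℝ} {N : ℕ}
    (h : 0 < μ (tailEvent ω s t r N)) :
    tailExponent μ ω s t r N = ((-Real.log (μ (tailEvent ω s t r N)).toReal / N : ℝ) : EReal) := by
  have h1 : tailExponent μ ω s t r N
      = -(ENNReal.log (μ (tailEvent ω s t r N)) / ((N : ℝ) : EReal)) := rfl
  rw [h1, ENNReal.log_pos_real h.ne' (measure_ne_top _ _), ← EReal.coe_div, ← EReal.coe_neg,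
    neg_div]

/-- The tail exponents converge in the interior of the domain, to a real limit. -/
lemma IsBernoulliEnv.exists_tendsto_tailExponent (hp0 : 0 < p) (hp1 : p < 1)
    (hω : IsBernoulliEnv μ p ω) {s t r : ℝ} (hs : 0 < s) (ht : 0 < t) (hr : r < s) :
    ∃ l : ℝ, Tendsto (tailExponent μ ω s t r) atTop (𝓝 (l : EReal)) := by
  have := hω.isProbabilityMeasure
  obtain ⟨K, hK⟩ := eventually_atTop.1 (hω.eventually_tailEvent_pos hp0 hp1 t hr)
  have hpos : ∀ N, K ≤ N → 0 < (μ (tailEvent ω s t r N)).toReal := fun N hN =>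
    ENNReal.toReal_pos (hK N hN).ne' (measure_ne_top _ _)
  obtain ⟨l, hl⟩ := exists_tendsto_div_of_subadditive_ge
    (a := fun N => -Real.log (μ (tailEvent ω s t r N)).toReal) (K := K)
    (fun n => neg_nonneg.2 (Real.log_nonpos ENNReal.toReal_nonneg measureReal_le_one))
    (fun M N hM hN => by
      have h := ENNReal.toReal_mono (measure_ne_top _ _)
        (hω.tailEvent_mul_le hp0 hp1 hs.le ht.le r M N)
      rw [ENNReal.toReal_mul] at h
      have h2 := Real.log_le_log (mul_pos (hpos M hM) (hpos N hN)) h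
      rw [Real.log_mul (hpos M hM).ne' (hpos N hN).ne'] at h2
      linarith)
  refine ⟨l, ((continuous_coe_real_ereal.tendsto l).comp hl).congr' ?_⟩
  filter_upwards [eventually_ge_atTop K] with N hN
  exact (tailExponent_eq_coe (hK N hN)).symm

lemma IsBernoulliEnv.tendsto_rateLimit (hp0 : 0 < p) (hp1 : p < 1)
    (hω : IsBernoulliEnv μ p ω) {y : ℝ × ℝ × ℝ} (hy : y ∈ rateInterior) :
    Tendsto (tailExponent μ ω y.1 y.2.1 y.2.2) atTop (𝓝 (rateLimit μ ω y)) := by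
  obtain ⟨l, hl⟩ := hω.exists_tendsto_tailExponent hp0 hp1 hy.1 hy.2.1 hy.2.2
  rw [rateLimit, hl.limsup_eq]
  exact hl

end Env

/-! ### Duality between tail exponents and exponential moments -/

section Env

variable {Ω : Type*} [MeasurableSpace Ω] {μ : Measure Ω} {p : ℝ} {ω : ℕ × ℕ → Ω → ℕ}

/-- Markov's inequality for `exp (ξ G)`. -/
lemma IsBernoulliEnv.le_tailExponent (hp0 : 0 < p) (hp1 : p < 1) (hω : IsBernoulliEnv μ p ω)
    {ξ : ℝ} (hξ : 0 ≤ ξ) (s t r : ℝ) {N : ℕ} (hN : 1 ≤ N) :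
    ((r * ξ - logMoment p ξ ⌊(N : ℝ) * s⌋₊ ⌊(N : ℝ) * t⌋₊ / N : ℝ) : EReal)
      ≤ tailExponent μ ω s t r N := by
  have := hω.isProbabilityMeasure
  have hN0 : (0 : ℝ) < N := by exact_mod_cast hN
  set A := logMoment p ξ ⌊(N : ℝ) * s⌋₊ ⌊(N : ℝ) * t⌋₊ with hA
  have hmarkov : ENNReal.ofReal (Real.exp (N * r * ξ)) * μ (tailEvent ω s t r N)
      ≤ ENNReal.ofReal (Real.exp A) := by
    rw [hA, ofReal_exp_logMoment hp0 hp1 hξ, ← hω.lintegral_lastPassage hp0 hp1,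
      ← setLIntegral_const]
    refine (setLIntegral_mono' (hω.measurableSet_tailEvent s t r N) fun x hx => ?_).trans
      (setLIntegral_le_lintegral _ _)
    rw [ofReal_exp_pow]
    exact ENNReal.ofReal_le_ofReal (Real.exp_le_exp.2 (mul_le_mul_of_nonneg_right hx hξ))
  rcases eq_or_ne (μ (tailEvent ω s t r N)) 0 with h | h
  · have h1 : tailExponent μ ω s t r N
        = -(ENNReal.log (μ (tailEvent ω s t r N)) / ((N : ℝ) : EReal)) := rfl
    rw [h1, h, ENNReal.log_zero, EReal.bot_div_of_pos_ne_top (by exact_mod_cast hN0)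
      (EReal.coe_ne_top _), EReal.neg_bot]
    exact le_top
  · rw [tailExponent_eq_coe (pos_iff_ne_zero.2 h), EReal.coe_le_coe_iff]
    have hpos := ENNReal.toReal_pos h (measure_ne_top _ _)
    rw [← ENNReal.ofReal_toReal (measure_ne_top μ (tailEvent ω s t r N)),
      ← ENNReal.ofReal_mul (Real.exp_pos _).le,
      ENNReal.ofReal_le_ofReal_iff (Real.exp_pos _).le] at hmarkov
    have hlog := Real.log_le_log (by positivity) hmarkov
    rw [Real.log_mul (Real.exp_pos _).ne' hpos.ne', Real.log_exp, Real.log_exp] at hlog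
    rw [le_div_iff₀ hN0, sub_mul, div_mul_cancel₀ _ hN0.ne']
    linarith

lemma IsBernoulliEnv.le_rateLimit (hp0 : 0 < p) (hp1 : p < 1) (hω : IsBernoulliEnv μ p ω)
    {ξ : ℝ} (hξ : 0 ≤ ξ) {c₁ c₂ : ℝ} (hc₁ : 0 ≤ c₁) (hc₂ : 0 ≤ c₂)
    (hA : ∀ m n : ℕ, logMoment p ξ m n ≤ m * c₁ + (n + 1) * c₂) {y : ℝ × ℝ × ℝ}
    (hy : y ∈ rateInterior) :
    ((y.2.2 * ξ - (y.1 * c₁ + y.2.1 * c₂) : ℝ) : EReal) ≤ rateLimit μ ω y := by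
  have h1 : Tendsto (fun N : ℕ => y.2.2 * ξ - (y.1 * c₁ + y.2.1 * c₂) - c₂ / (N : ℝ)) atTop
      (𝓝 (y.2.2 * ξ - (y.1 * c₁ + y.2.1 * c₂) - 0)) :=
    tendsto_const_nhds.sub (tendsto_const_nhds.div_atTop tendsto_natCast_atTop_atTop)
  rw [sub_zero] at h1
  refine le_of_tendsto_of_tendsto ((continuous_coe_real_ereal.tendsto _).comp h1)
    (hω.tendsto_rateLimit hp0 hp1 hy) ?_
  filter_upwards [eventually_ge_atTop 1] with N hN
  refine le_trans ?_ (hω.le_tailExponent hp0 hp1 hξ _ _ _ hN)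
  have hN0 : (0 : ℝ) < N := by exact_mod_cast hN
  rw [Function.comp_apply, EReal.coe_le_coe_iff]
  have hb := hA ⌊(N : ℝ) * y.1⌋₊ ⌊(N : ℝ) * y.2.1⌋₊
  have e1 := mul_le_mul_of_nonneg_right (Nat.floor_le (mul_nonneg hN0.le hy.1.le)) hc₁
  have e2 := mul_le_mul_of_nonneg_right (Nat.floor_le (mul_nonneg hN0.le hy.2.1.le)) hc₂
  have hdiv : logMoment p ξ ⌊(N : ℝ) * y.1⌋₊ ⌊(N : ℝ) * y.2.1⌋₊ / N
      ≤ (y.1 * c₁ + y.2.1 * c₂) + c₂ / N := by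
    rw [div_le_iff₀ hN0, add_mul, div_mul_cancel₀ _ hN0.ne']
    linarith
  linarith

/-- The lower bound for the rate function passes to the boundary of the domain by continuity. -/
lemma IsBernoulliEnv.le_rateJ (hp0 : 0 < p) (hp1 : p < 1) (hω : IsBernoulliEnv μ p ω)
    {ξ : ℝ} (hξ : 0 ≤ ξ) {c₁ c₂ : ℝ} (hc₁ : 0 ≤ c₁) (hc₂ : 0 ≤ c₂)
    (hA : ∀ m n : ℕ, logMoment p ξ m n ≤ m * c₁ + (n + 1) * c₂) (s t r : ℝ) :
    ((r * ξ - (s * c₁ + t * c₂) : ℝ) : EReal) ≤ rateJ μ ω s t r := by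
  rw [rateJ]
  split_ifs with h1 h2
  · exact hω.le_rateLimit hp0 hp1 hξ hc₁ hc₂ hA h1
  · refine le_of_forall_lt fun z hz => ?_
    obtain ⟨z', hz1, hz2⟩ := exists_between hz
    refine hz1.trans_le (le_liminf_of_le (by isBoundedDefault) ?_)
    have hcont : Continuous fun y : ℝ × ℝ × ℝ =>
        ((y.2.2 * ξ - (y.1 * c₁ + y.2.1 * c₂) : ℝ) : EReal) :=
      continuous_coe_real_ereal.comp (by fun_prop)
    have hev := (hcont.tendsto (s, t, r)).eventually (lt_mem_nhds hz2)
    filter_upwards [nhdsWithin_le_nhds hev, self_mem_nhdsWithin] with y hy hyI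
    exact hy.le.trans (hω.le_rateLimit hp0 hp1 hξ hc₁ hc₂ hA hyI)
  · exact le_top

lemma coe_sub_le_of_coe_le {a b : ℝ} {J : EReal} (h : ((a - b : ℝ) : EReal) ≤ J) :
    (a : EReal) - J ≤ (b : EReal) := by
  induction J with
  | bot => exact absurd (le_bot_iff.1 h) (EReal.coe_ne_bot _)
  | coe x =>
    rw [EReal.coe_le_coe_iff] at h
    rw [← EReal.coe_sub, EReal.coe_le_coe_iff]
    linarith
  | top => simp

lemma coe_le_coe_sub {a b : ℝ} {J : EReal} (h : J ≤ ((a - b : ℝ) : EReal)) :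
    (b : EReal) ≤ (a : EReal) - J := by
  induction J with
  | bot => simp
  | coe x =>
    rw [EReal.coe_le_coe_iff] at h
    rw [← EReal.coe_sub, EReal.coe_le_coe_iff]
    linarith
  | top => exact absurd (top_le_iff.1 h) (EReal.coe_ne_top _)

lemma IsBernoulliEnv.legendreDual_le (hp0 : 0 < p) (hp1 : p < 1) (hω : IsBernoulliEnv μ p ω)
    {ξ : ℝ} (hξ : 0 ≤ ξ) {c₁ c₂ : ℝ} (hc₁ : 0 ≤ c₁) (hc₂ : 0 ≤ c₂)
    (hA : ∀ m n : ℕ, logMoment p ξ m n ≤ m * c₁ + (n + 1) * c₂) (s t : ℝ) :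
    legendreDual (rateJ μ ω s t) ξ ≤ ((s * c₁ + t * c₂ : ℝ) : EReal) :=
  iSup_le fun r => coe_sub_le_of_coe_le (hω.le_rateJ hp0 hp1 hξ hc₁ hc₂ hA s t r)

lemma measure_tailEvent_le_of_lt [IsProbabilityMeasure μ] {s t r c : ℝ} {N : ℕ} (hN : 1 ≤ N)
    (h : (c : EReal) < tailExponent μ ω s t r N) :
    μ (tailEvent ω s t r N) ≤ ENNReal.ofReal (Real.exp (-(N * c))) := by
  have hN0 : (0 : ℝ) < N := by exact_mod_cast hN
  rcases eq_or_ne (μ (tailEvent ω s t r N)) 0 with h0 | h0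
  · rw [h0]; exact zero_le
  · rw [tailExponent_eq_coe (pos_iff_ne_zero.2 h0), EReal.coe_lt_coe_iff, lt_div_iff₀ hN0] at h
    rw [← ENNReal.ofReal_toReal (measure_ne_top μ (tailEvent ω s t r N))]
    refine ENNReal.ofReal_le_ofReal ?_
    rw [← Real.log_le_iff_le_exp (ENNReal.toReal_pos h0 (measure_ne_top _ _))]
    linarith

/-- If `E exp (ξ G)` grows at rate at least `c`, some tail probability has to account for it: the
values of `G` are sorted into finitely many bins of width `N s / K`. -/
lemma IsBernoulliEnv.exists_rateLimit_le (hp0 : 0 < p) (hp1 : p < 1) (hω : IsBernoulliEnv μ p ω)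
    {ξ : ℝ} (hξ : 0 ≤ ξ) {s t c : ℝ} (hs : 0 < s) (ht : 0 < t)
    (hA : ∀ ε > 0, ∀ᶠ N : ℕ in atTop,
      N * (c - ε) ≤ logMoment p ξ ⌊(N : ℝ) * s⌋₊ ⌊(N : ℝ) * t⌋₊) {δ : ℝ} (hδ : 0 < δ) :
    ∃ r, 0 ≤ r ∧ r < s ∧ rateLimit μ ω (s, t, r) ≤ ((r * ξ - (c - δ) : ℝ) : EReal) := by
  have := hω.isProbabilityMeasure
  by_contra! hcon
  obtain ⟨K, hK⟩ := exists_nat_gt (s * ξ / (δ / 4))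
  have hK0 : (0 : ℝ) < K := lt_of_le_of_lt (by positivity) hK
  have hKδ : s * ξ / K ≤ δ / 4 := by
    rw [div_lt_iff₀ (by positivity)] at hK
    rw [div_le_iff₀ hK0]
    linarith
  have hr : ∀ j : ℕ, j < K → 0 ≤ s * j / K ∧ s * j / K < s := by
    intro j hj
    have hj' : (j : ℝ) < K := by exact_mod_cast hj
    refine ⟨by positivity, ?_⟩
    rw [div_lt_iff₀ hK0]
    nlinarith
  have hev : ∀ j ∈ Finset.range K, ∀ᶠ N : ℕ in atTop,
      ((s * j / K * ξ - (c - δ) : ℝ) : EReal) < tailExponent μ ω s t (s * j / K) N := by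
    intro j hj
    obtain ⟨h0, h1⟩ := hr j (Finset.mem_range.1 hj)
    exact (hω.tendsto_rateLimit hp0 hp1 (y := (s, t, s * j / K)) ⟨hs, ht, h1⟩).eventually
      (lt_mem_nhds (hcon _ h0 h1))
  have hev' := (Finset.eventually_all (Finset.range K)).2 hev
  have hbig : ∀ᶠ N : ℕ in atTop, Real.log K < δ / 2 * N := by
    have h := (tendsto_natCast_atTop_atTop (R := ℝ)).eventually
      (eventually_gt_atTop (Real.log K / (δ / 2)))
    filter_upwards [h] with N hN
    rw [div_lt_iff₀ (by positivity)] at hN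
    linarith
  obtain ⟨N, hN1, hNA, hNtail, hNbig⟩ := ((eventually_ge_atTop 1).and
    ((hA (δ / 4) (by positivity)).and (hev'.and hbig))).exists
  have hN0 : (0 : ℝ) < N := by exact_mod_cast hN1
  have hbins : ENNReal.ofReal (Real.exp (logMoment p ξ ⌊(N : ℝ) * s⌋₊ ⌊(N : ℝ) * t⌋₊))
      ≤ ∑ j ∈ Finset.range K, ENNReal.ofReal (Real.exp (N * (s * (j + 1) / K) * ξ)) *
        μ (tailEvent ω s t (s * j / K) N) := by
    have hme : ∀ j : ℕ, MeasurableSet (tailEvent ω s t (s * j / K) N) := fun j =>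
      hω.measurableSet_tailEvent _ _ _ _
    rw [ofReal_exp_logMoment hp0 hp1 hξ, ← hω.lintegral_lastPassage hp0 hp1]
    calc _ ≤ ∫⁻ x, ∑ j ∈ Finset.range K, (tailEvent ω s t (s * j / K) N).indicator
            (fun _ => ENNReal.ofReal (Real.exp (N * (s * (j + 1) / K) * ξ))) x ∂μ := by
          refine lintegral_mono_ae ?_
          filter_upwards [hω.ae_le_one hp0 hp1] with x hx
          set G := lastPassage (fun v => ω v x) ⌊(N : ℝ) * s⌋₊ ⌊(N : ℝ) * t⌋₊ with hG
          have hGm : (G : ℝ) ≤ N * s := by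
            have h1 : G ≤ ⌊(N : ℝ) * s⌋₊ := by
              rw [hG, lastPassage_eq_lpp]
              exact lpp_le_of_weights_le_one hx _ _
            exact (Nat.cast_le.2 h1).trans (Nat.floor_le (by positivity))
          set q : ℝ := G * K / (N * s) with hq
          have hq0 : 0 ≤ q := by positivity
          have hqK : q ≤ K := by
            rw [hq, div_le_iff₀ (by positivity)]
            nlinarith
          have hGq : (G : ℝ) = N * s * q / K := by
            rw [hq]; field_simp
          clear_value q
          have hceil : ⌈q⌉₊ ≤ K := Nat.ceil_le.2 hqK
          have hKpos : 0 < K := by exact_mod_cast hK0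
          have hj : ⌈q⌉₊ - 1 < K := by omega
          have hjq : ((⌈q⌉₊ - 1 : ℕ) : ℝ) ≤ q := by
            rcases Nat.eq_zero_or_pos ⌈q⌉₊ with h | h
            · simpa [h] using hq0
            · rw [Nat.cast_sub h]
              have := Nat.ceil_lt_add_one hq0
              push_cast
              linarith
          have hqj : q ≤ ((⌈q⌉₊ - 1 : ℕ) : ℝ) + 1 := by
            refine (Nat.le_ceil q).trans ?_
            have h : ⌈q⌉₊ ≤ (⌈q⌉₊ - 1) + 1 := by omega
            exact_mod_cast h
          refine le_trans ?_ (Finset.single_le_sum (fun _ _ => zero_le) (Finset.mem_range.2 hj))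
          have hmem : x ∈ tailEvent ω s t (s * ((⌈q⌉₊ - 1 : ℕ) : ℝ) / K) N := by
            change (N : ℝ) * (s * ((⌈q⌉₊ - 1 : ℕ) : ℝ) / K) ≤ (G : ℝ)
            rw [hGq, ← mul_div_assoc, ← mul_assoc]
            gcongr
          rw [Set.indicator_of_mem hmem, ofReal_exp_pow]
          refine ENNReal.ofReal_le_ofReal (Real.exp_le_exp.2 ?_)
          refine mul_le_mul_of_nonneg_right ?_ hξ
          rw [hGq, ← mul_div_assoc, ← mul_assoc]
          gcongr
      _ = _ := by
          rw [lintegral_finsetSum _ fun j _ => measurable_const.indicator (hme j)]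
          refine Finset.sum_congr rfl fun j _ => ?_
          rw [lintegral_indicator_const (hme j)]
  have hsum : ∑ j ∈ Finset.range K, ENNReal.ofReal (Real.exp (N * (s * (j + 1) / K) * ξ)) *
        μ (tailEvent ω s t (s * j / K) N)
      ≤ ∑ _j ∈ Finset.range K, ENNReal.ofReal (Real.exp (N * (c - 3 * δ / 4))) := by
    refine Finset.sum_le_sum fun j hj => ?_
    refine (mul_le_mul_right (measure_tailEvent_le_of_lt hN1 (hNtail j hj)) _).trans ?_
    rw [← ENNReal.ofReal_mul (Real.exp_pos _).le, ← Real.exp_add]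
    refine ENNReal.ofReal_le_ofReal (Real.exp_le_exp.2 ?_)
    have e : N * (s * (j + 1) / K) * ξ + -(N * (s * j / K * ξ - (c - δ)))
        = N * (s * ξ / K) + N * (c - δ) := by
      field_simp; ring
    rw [e]
    nlinarith
  have htot := hbins.trans hsum
  rw [Finset.sum_const, Finset.card_range, nsmul_eq_mul, ← ENNReal.ofReal_natCast,
    ← ENNReal.ofReal_mul hK0.le, ENNReal.ofReal_le_ofReal_iff (by positivity)] at htot
  have hlog := Real.log_le_log (Real.exp_pos _) htot
  rw [Real.log_exp, Real.log_mul hK0.ne' (Real.exp_pos _).ne', Real.log_exp] at hlog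
  nlinarith

lemma IsBernoulliEnv.le_legendreDual (hp0 : 0 < p) (hp1 : p < 1) (hω : IsBernoulliEnv μ p ω)
    {ξ : ℝ} (hξ : 0 ≤ ξ) {s t c : ℝ} (hs : 0 < s) (ht : 0 < t)
    (hA : ∀ ε > 0, ∀ᶠ N : ℕ in atTop,
      N * (c - ε) ≤ logMoment p ξ ⌊(N : ℝ) * s⌋₊ ⌊(N : ℝ) * t⌋₊) :
    (c : EReal) ≤ legendreDual (rateJ μ ω s t) ξ := by
  refine EReal.ge_of_forall_gt_iff_ge.1 fun z hz => ?_
  rw [EReal.coe_lt_coe_iff] at hz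
  obtain ⟨r, -, hrs, h⟩ := hω.exists_rateLimit_le hp0 hp1 hξ hs ht hA (sub_pos.2 hz)
  rw [sub_sub_cancel] at h
  have hJ : rateJ μ ω s t r = rateLimit μ ω (s, t, r) := if_pos ⟨hs, ht, hrs⟩
  rw [← hJ] at h
  exact (coe_le_coe_sub h).trans (le_iSup (fun x : ℝ => ((x * ξ : ℝ) : EReal) - rateJ μ ω s t x) r)

/-- On the boundary `s = 0` or `t = 0`, the rate function is a lower limit, and a maximizer is
found as a limit point of almost maximizers in the interior. -/
lemma IsBernoulliEnv.le_legendreDual_boundary (hp0 : 0 < p) (hp1 : p < 1)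
    (hω : IsBernoulliEnv μ p ω) {ξ : ℝ} (hξ : 0 ≤ ξ) {s t : ℝ} (hs : 0 ≤ s) (ht : 0 ≤ t)
    (hst : s = 0 ∨ t = 0) :
    ((s * hLog ξ p : ℝ) : EReal) ≤ legendreDual (rateJ μ ω s t) ξ := by
  have hL := hLog_nonneg hξ hp0.le
  have hη : ∀ n : ℕ, (0 : ℝ) < 1 / ((n : ℝ) + 1) := fun n => Nat.one_div_pos_of_nat
  have hex : ∀ n : ℕ, ∃ r, 0 ≤ r ∧ r < s + 1 / ((n : ℝ) + 1) ∧
      rateLimit μ ω (s + 1 / ((n : ℝ) + 1), t + 1 / ((n : ℝ) + 1), r)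
        ≤ ((r * ξ - (s * hLog ξ p - 1 / ((n : ℝ) + 1)) : ℝ) : EReal) := by
    intro n
    refine hω.exists_rateLimit_le hp0 hp1 hξ (by linarith [hη n]) (by linarith [hη n])
      (fun ε hε => ?_) (hη n)
    have hbig := (tendsto_natCast_atTop_atTop (R := ℝ)).eventually
      (eventually_ge_atTop (hLog ξ p / ε))
    filter_upwards [hbig] with N hN
    refine le_trans ?_ (mul_hLog_le_logMoment hp0 hp1 hξ _ _)
    rw [div_le_iff₀ hε] at hN
    have h1 := Nat.lt_floor_add_one ((N : ℝ) * (s + 1 / ((n : ℝ) + 1)))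
    have h2 : (N : ℝ) * s ≤ N * (s + 1 / ((n : ℝ) + 1)) :=
      mul_le_mul_of_nonneg_left (by linarith [hη n]) N.cast_nonneg
    have h3 := mul_le_mul_of_nonneg_right (h2.trans h1.le) hL
    linarith
  choose r hr0 hrs hr using hex
  have hη1 : ∀ n : ℕ, 1 / ((n : ℝ) + 1) ≤ 1 := fun n => by
    rw [div_le_one (by positivity)]
    linarith [n.cast_nonneg (α := ℝ)]
  obtain ⟨r₀, -, φ, hφ, hlim⟩ := (isCompact_Icc (a := (0 : ℝ)) (b := s + 1)).tendsto_subseq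
    (x := r) fun n => ⟨hr0 n, by linarith [hrs n, hη1 n]⟩
  have hη0 : Tendsto (fun n : ℕ => 1 / ((φ n : ℝ) + 1)) atTop (𝓝 0) :=
    tendsto_one_div_add_atTop_nhds_zero_nat.comp hφ.tendsto_atTop
  have hs' : Tendsto (fun n => s + 1 / ((φ n : ℝ) + 1)) atTop (𝓝 s) := by
    simpa using hη0.const_add s
  have ht' : Tendsto (fun n => t + 1 / ((φ n : ℝ) + 1)) atTop (𝓝 t) := by
    simpa using hη0.const_add t
  have hr₀s : r₀ ≤ s := le_of_tendsto_of_tendsto' hlim hs' fun n => (hrs (φ n)).le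
  have hy : Tendsto (fun n => (s + 1 / ((φ n : ℝ) + 1), t + 1 / ((φ n : ℝ) + 1), r (φ n))) atTop
      (𝓝[rateInterior] (s, t, r₀)) := by
    refine tendsto_nhdsWithin_iff.2 ⟨hs'.prodMk_nhds (ht'.prodMk_nhds hlim), ?_⟩
    refine Eventually.of_forall fun n => ⟨?_, ?_, hrs (φ n)⟩
    · change 0 < s + 1 / ((φ n : ℝ) + 1)
      linarith [hη (φ n)]
    · change 0 < t + 1 / ((φ n : ℝ) + 1)
      linarith [hη (φ n)]
  have hJ : rateJ μ ω s t r₀ = liminf (rateLimit μ ω) (𝓝[rateInterior] (s, t, r₀)) := by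
    rw [rateJ, if_neg, if_pos ⟨hs, ht, hr₀s⟩]
    rintro ⟨h1, h2, -⟩
    have h1 : 0 < s := h1
    have h2 : 0 < t := h2
    rcases hst with h | h <;> linarith
  have hval : Tendsto (fun n => r (φ n) * ξ - (s * hLog ξ p - 1 / ((φ n : ℝ) + 1))) atTop
      (𝓝 (r₀ * ξ - s * hLog ξ p)) := by
    simpa using (hlim.mul_const ξ).sub (hη0.const_sub (s * hLog ξ p))
  have hJle : rateJ μ ω s t r₀ ≤ ((r₀ * ξ - s * hLog ξ p : ℝ) : EReal) := by
    rw [hJ]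
    refine EReal.le_of_forall_lt_iff_le.1 fun z hz => ?_
    rw [EReal.coe_lt_coe_iff] at hz
    refine liminf_le_of_frequently_le' (hy.frequently (Eventually.frequently ?_))
    filter_upwards [hval.eventually (gt_mem_nhds hz)] with n hn
    exact (hr (φ n)).trans (EReal.coe_le_coe_iff.2 hn.le)
  exact (coe_le_coe_sub hJle).trans
    (le_iSup (fun x : ℝ => ((x * ξ : ℝ) : EReal) - rateJ μ ω s t x) r₀)

end Env

/-! ### The closed form -/

/-- The critical parameter in a direction below the flat edge. With `X = 1 + u (E - 1)`, the
critical equation reads `s D X ^ 2 - (s (2 + k) + t k) X + s D' = 0`, where `D = 1 - p (1 - y)`,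
`D' = 1 + p (E - 1)`, `k = p (1 - p) (E + y - 2)` and `D D' = 1 + k`; its discriminant is `Δ`, and
`u` belongs to the larger root. -/
lemma exists_critical_param {p s t E y R : ℝ} (hp0 : 0 < p) (hp1 : p < 1) (hE : 1 < E)
    (hEy : E * y = 1) (hs : 0 < s) (ht : 0 < t) (hst : t * p < (1 - p) * s) (hR : 0 ≤ R)
    (hR2 : R ^ 2 = p * (1 - p) * (E + y - 2) *
      (p * (1 - p) * (s + t) ^ 2 * (E + y - 2) + 4 * s * t)) :
    ∃ u, p < u ∧ u < 1 ∧
      s * ((u * (1 - p + p * y) - p * y) * (u - p)) * E = t * (p * (1 - p)) * (1 - u + u * E) ∧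
      1 - u + u * E
        = (p * (1 - p) * (s + t) * (E + y - 2) + 2 * s + R) / (2 * s * (1 - p * (1 - y))) ∧
      (u * (1 - p + p * y) - p * y) / (u - p)
        = (p * (1 - p) * (s + t) * (E + y - 2) + R) * (1 - p * (1 - y)) /
          (p * (1 - p) * (t - s) * (E + y - 2) + R) := by
  have hy0 : 0 < y := by
    by_contra h
    nlinarith
  have hy1 : y < 1 := by
    by_contra h
    nlinarith
  have hq : 0 < 1 - p := by linarith
  have hc : E + y - 2 = (E - 1) * (1 - y) := by linear_combination hEy
  have hcpos : 0 < E + y - 2 := by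
    rw [hc]; exact mul_pos (by linarith) (by linarith)
  obtain ⟨k, hk⟩ : ∃ k, k = p * (1 - p) * (E + y - 2) := ⟨_, rfl⟩
  have hkpos : 0 < k := by rw [hk]; exact mul_pos (mul_pos hp0 hq) hcpos
  obtain ⟨D, hD⟩ : ∃ D, D = 1 - p * (1 - y) := ⟨_, rfl⟩
  have hDpos : 0 < D := by rw [hD]; nlinarith
  have hDD : D * (1 + p * (E - 1)) = 1 + k := by
    rw [hD, hk]; linear_combination p ^ 2 * hEy
  have ha : 0 < E - 1 := by linarith
  have hay : (E - 1) * y = 1 - y := by linear_combination hEy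
  have e1 : p * (1 - p) * (s + t) * (E + y - 2) = k * (s + t) := by rw [hk]; ring
  have e2 : p * (1 - p) * (t - s) * (E + y - 2) = k * (t - s) := by rw [hk]; ring
  have e3 : 1 - p + p * y = D := by rw [hD]; ring
  have hR2' : R ^ 2 = k * (k * (s + t) ^ 2 + 4 * s * t) := by rw [hR2, hk]; ring
  rw [e1, e2, e3, ← hD]
  obtain ⟨X, hX⟩ : ∃ X, X = (k * (s + t) + 2 * s + R) / (2 * s * D) := ⟨_, rfl⟩
  have hsD : 0 < 2 * s * D := by positivity
  have hXeq : X * (2 * s * D) = k * (s + t) + 2 * s + R := by rw [hX, div_mul_cancel₀ _ hsD.ne']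
  have hRgt : k * (s - t) < R := by
    refine lt_of_pow_lt_pow_left₀ 2 hR ?_
    rw [hR2']
    have h1 : k * (k * (s + t) ^ 2 + 4 * s * t)
        = (k * (s - t)) ^ 2 + (4 * (k * (s * t)) + 4 * (k * k * (s * t))) := by ring
    have h2 := mul_pos hkpos (mul_pos hs ht)
    have h3 := mul_pos (mul_pos hkpos hkpos) (mul_pos hs ht)
    linarith
  have hRlt : R < 2 * s * (1 - p) * (E - 1) - k * (s + t) := by
    have hkW : k = (1 - p) * (E - 1) * (p * (1 - y)) := by rw [hk, hc]; ring
    have hpy : p * (1 - y) * (s + t) < 2 * s := by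
      have : p * (1 - y) * (s + t) ≤ p * (s + t) := by
        have h1 : p * (1 - y) ≤ p := mul_le_of_le_one_right hp0.le (by linarith)
        exact mul_le_mul_of_nonneg_right h1 (by linarith)
      linarith
    have hW : 0 ≤ 2 * s * (1 - p) * (E - 1) - k * (s + t) := by
      have h1 : 2 * s * (1 - p) * (E - 1) - k * (s + t)
          = (1 - p) * (E - 1) * (2 * s - p * (1 - y) * (s + t)) := by rw [hkW]; ring
      rw [h1]
      exact mul_nonneg (mul_pos hq ha).le (by linarith)
    refine lt_of_pow_lt_pow_left₀ 2 hW ?_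
    have hka : k = p * (1 - p) * (E - 1) ^ 2 * y := by
      rw [hkW]; linear_combination -((1 - p) * (E - 1) * p) * hay
    have hdiff : (2 * s * (1 - p) * (E - 1) - k * (s + t)) ^ 2 - R ^ 2
        = 4 * s * (1 - p) * (E - 1) ^ 2 * (D * ((1 - p) * s - t * p)) := by
      rw [hR2', hD]
      have h1 : (2 * s * (1 - p) * (E - 1) - k * (s + t)) ^ 2 - k * (k * (s + t) ^ 2 + 4 * s * t)
          = 4 * s * (s * (1 - p) ^ 2 * (E - 1) ^ 2 - (1 - p) * (E - 1) * k * (s + t) - t * k) := by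
        ring
      rw [h1, hka]
      linear_combination -(4 * s * (1 - p) ^ 2 * (E - 1) ^ 2 * p * (s + t)) * hay
    have hpos : 0 < 4 * s * (1 - p) * (E - 1) ^ 2 * (D * ((1 - p) * s - t * p)) :=
      mul_pos (mul_pos (mul_pos (by linarith) hq) (pow_pos ha 2)) (mul_pos hDpos (by linarith))
    linarith
  have hu : ((X - 1) / (E - 1)) * (E - 1) = X - 1 := div_mul_cancel₀ _ ha.ne'
  obtain ⟨u, hudef⟩ : ∃ u, u = (X - 1) / (E - 1) := ⟨_, rfl⟩
  rw [← hudef] at hu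
  -- the three factors of the critical equation in terms of `X`
  have f1 : 1 - u + u * E = X := by linear_combination hu
  have f2 : (u * D - p * y) * (E - 1) = D * X - 1 := by
    linear_combination D * hu - p * hay - hD
  have f3 : (u - p) * (E - 1) = X - (1 + p * (E - 1)) := by linear_combination hu
  have g2 : 2 * s * (D * X - 1) = k * (s + t) + R := by linear_combination hXeq
  have g3 : 2 * s * D * (X - (1 + p * (E - 1))) = k * (t - s) + R := by
    linear_combination hXeq - 2 * s * hDD
  have hup : 0 < u - p := by
    have h1 : 0 < 2 * s * D * ((u - p) * (E - 1)) := by rw [f3, g3]; linarith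
    exact pos_of_mul_pos_left (pos_of_mul_pos_right h1 hsD.le) ha.le
  have hu1 : 0 < 1 - u := by
    have h1 : 0 < 2 * s * D * ((1 - u) * (E - 1)) := by
      have h2 : 2 * s * D * ((1 - u) * (E - 1))
          = 2 * s * (1 - p) * (E - 1) - k * (s + t) - R := by
        have hDE : D * E = 1 + (1 - p) * (E - 1) := by rw [hD]; linear_combination p * hEy
        linear_combination -(2 * s * D) * hu - hXeq + 2 * s * hDE
      rw [h2]; linarith
    exact pos_of_mul_pos_left (pos_of_mul_pos_right h1 hsD.le) ha.le
  refine ⟨u, by linarith, by linarith, ?_, by rw [f1, hX], ?_⟩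
  · -- the quadratic equation for `X`
    have hquad : s * ((D * X - 1) * (X - (1 + p * (E - 1)))) = t * k * X := by
      have h1 : (4 * s * D) * (s * ((D * X - 1) * (X - (1 + p * (E - 1)))))
          = (4 * s * D) * (t * k * X) := by
        calc (4 * s * D) * (s * ((D * X - 1) * (X - (1 + p * (E - 1)))))
            = (2 * s * (D * X - 1)) * (2 * s * D * (X - (1 + p * (E - 1)))) := by ring
          _ = (k * (s + t) + R) * (k * (t - s) + R) := by rw [g2, g3]
          _ = 2 * t * k * (X * (2 * s * D)) := by rw [hXeq]; linear_combination hR2'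
          _ = _ := by ring
      exact mul_left_cancel₀ (by positivity) h1
    have hEa : k * E = p * (1 - p) * (E - 1) ^ 2 := by
      rw [hk]; linear_combination p * (1 - p) * hEy
    rw [f1]
    refine mul_right_cancel₀ (pow_pos ha 2).ne' ?_
    calc s * ((u * D - p * y) * (u - p)) * E * (E - 1) ^ 2
        = s * (((u * D - p * y) * (E - 1)) * ((u - p) * (E - 1))) * E := by ring
      _ = t * k * X * E := by rw [f2, f3, hquad]
      _ = t * (k * E) * X := by ring
      _ = _ := by rw [hEa]; ring
  · have hpos : 0 < k * (t - s) + R := by linarith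
    rw [div_eq_div_iff hup.ne' hpos.ne', ← g3, ← g2, ← f2, ← f3]
    ring

section Env

variable {Ω : Type*} [MeasurableSpace Ω] {μ : Measure Ω} {p : ℝ} {ω : ℕ × ℕ → Ω → ℕ}

lemma IsBernoulliEnv.legendreDual_zero (hp0 : 0 < p) (hp1 : p < 1) (hω : IsBernoulliEnv μ p ω)
    {s t : ℝ} (hs : 0 ≤ s) (ht : 0 ≤ t) : legendreDual (rateJ μ ω s t) 0 = 0 := by
  refine le_antisymm ?_ ?_
  · have h := hω.legendreDual_le hp0 hp1 le_rfl (le_refl 0) (le_refl 0)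
      (fun m n => by simpa using hω.logMoment_le_mul hp0 hp1 le_rfl m n) s t
    simpa using h
  · by_cases hst : s = 0 ∨ t = 0
    · have h := hω.le_legendreDual_boundary hp0 hp1 (le_refl 0) hs ht hst
      simpa [hLog] using h
    · push Not at hst
      have h := hω.le_legendreDual hp0 hp1 (c := 0) (le_refl 0) (lt_of_le_of_ne hs hst.1.symm)
        (lt_of_le_of_ne ht hst.2.symm) (fun ε hε => Eventually.of_forall fun N => by
          have h1 := logMoment_nonneg hp0 hp1 (le_refl 0) ⌊(N : ℝ) * s⌋₊ ⌊(N : ℝ) * t⌋₊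
          have h2 : 0 ≤ (N : ℝ) * ε := by positivity
          linarith)
      simpa using h

/-- On the flat edge the critical parameter is `u = 1`, the end of the parameter range; it is
approached by critical parameters of directions `(s, t')` with `t' ≤ t`. -/
lemma IsBernoulliEnv.legendreDual_flat (hp0 : 0 < p) (hp1 : p < 1) (hω : IsBernoulliEnv μ p ω)
    {s t ξ : ℝ} (hs : 0 ≤ s) (ht : 0 ≤ t) (hξ : 0 < ξ) (hst : (1 - p) / p * s ≤ t) :
    legendreDual (rateJ μ ω s t) ξ = ((s * ξ : ℝ) : EReal) := by
  refine le_antisymm ?_ ?_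
  · have h := hω.legendreDual_le hp0 hp1 hξ.le hξ.le (le_refl 0)
      (fun m n => by simpa using hω.logMoment_le_mul hp0 hp1 hξ.le m n) s t
    simpa using h
  rcases hs.eq_or_lt with rfl | hs
  · simpa using hω.le_legendreDual_boundary hp0 hp1 hξ.le le_rfl ht (Or.inl rfl)
  have htpos : 0 < t := lt_of_lt_of_le (mul_pos (div_pos (by linarith) hp0) hs) hst
  refine hω.le_legendreDual hp0 hp1 hξ.le hs htpos fun ε hε => ?_
  have hcont : ContinuousAt (hLog ξ) 1 := (hasDerivAt_hLog hξ.le zero_le_one).continuousAt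
  have h1 : hLog ξ 1 = ξ := by simp [hLog]
  have hev : ∀ᶠ u in 𝓝[<] (1 : ℝ), ξ - ε / (2 * s) < hLog ξ u ∧ p < u ∧ u < 1 := by
    have e1 := hcont.eventually (lt_mem_nhds (a := ξ - ε / (2 * s)) (by
      rw [h1]; have : 0 < ε / (2 * s) := by positivity
      linarith))
    filter_upwards [nhdsWithin_le_nhds e1, nhdsWithin_le_nhds (lt_mem_nhds hp1),
      self_mem_nhdsWithin] with u hu1 hu2 hu3
    exact ⟨hu1, hu2, hu3⟩
  obtain ⟨u, hLu, hpu, hu⟩ := hev.exists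
  have hE : 1 < Real.exp ξ := Real.one_lt_exp_iff.2 hξ
  have hy0 := Real.exp_pos (-ξ)
  have hL := hLog_arg_ge_one hξ.le (by linarith : 0 ≤ u)
  have hup : 0 < u - p := by linarith
  have hpos : 0 < u * (1 - p + p * Real.exp (-ξ)) - p * Real.exp (-ξ) := by
    have h := vLog_arg_ge_one hp0 hξ.le hpu hu
    rw [le_div_iff₀ hup] at h
    linarith
  have hden : 0 < p * (1 - p) * (1 - u + u * Real.exp ξ) :=
    mul_pos (mul_pos hp0 (by linarith)) (by linarith)
  set t' := s * ((u * (1 - p + p * Real.exp (-ξ)) - p * Real.exp (-ξ)) * (u - p)) * Real.exp ξ /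
    (p * (1 - p) * (1 - u + u * Real.exp ξ)) with ht'
  have ht'pos : 0 < t' := by positivity
  have ht't : t' ≤ t := by
    refine le_trans ?_ hst
    rw [ht', div_le_iff₀ hden]
    have e1 : u * (1 - p + p * Real.exp (-ξ)) - p * Real.exp (-ξ) ≤ u * (1 - p) := by
      nlinarith [mul_nonneg (mul_nonneg hp0.le hy0.le) (by linarith : 0 ≤ 1 - u)]
    have e2 : (u * (1 - p + p * Real.exp (-ξ)) - p * Real.exp (-ξ)) * (u - p)
        ≤ u * (1 - p) * (1 - p) :=
      mul_le_mul e1 (by linarith) hup.le (mul_nonneg (by linarith) (by linarith))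
    have e3 : s * ((u * (1 - p + p * Real.exp (-ξ)) - p * Real.exp (-ξ)) * (u - p)) * Real.exp ξ
        ≤ s * (u * (1 - p) * (1 - p)) * Real.exp ξ := by gcongr
    refine e3.trans ?_
    have e4 : (1 - p) / p * s * (p * (1 - p) * (1 - u + u * Real.exp ξ))
        = s * ((1 - p) * (1 - p)) * (1 - u + u * Real.exp ξ) := by field_simp
    rw [e4]
    nlinarith [mul_nonneg (mul_nonneg hs.le (mul_self_nonneg (1 - p))) (by linarith : 0 ≤ 1 - u)]
  have hmain := eventually_le_logMoment hp0 hp1 hξ hpu hu hs ht'pos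
    (by rw [mul_assoc t', ht', div_mul_cancel₀ _ hden.ne']) (half_pos hε)
  filter_upwards [hmain] with N hN
  refine le_trans ?_ (hN.trans (logMoment_mono hp0 hp1 hξ.le le_rfl
    (Nat.floor_le_floor (mul_le_mul_of_nonneg_left ht't N.cast_nonneg))))
  refine mul_le_mul_of_nonneg_left ?_ N.cast_nonneg
  have hv := mul_nonneg ht'pos.le (vLog_nonneg hp0 hξ.le hpu hu)
  have hsL : s * (ξ - ε / (2 * s)) ≤ s * hLog ξ u := mul_le_mul_of_nonneg_left hLu.le hs.le
  have e : s * (ξ - ε / (2 * s)) = s * ξ - ε / 2 := by field_simp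
  linarith

lemma IsBernoulliEnv.legendreDual_of_critical (hp0 : 0 < p) (hp1 : p < 1)
    (hω : IsBernoulliEnv μ p ω) {s t ξ u : ℝ} (hs : 0 < s) (ht : 0 < t) (hξ : 0 < ξ)
    (hpu : p < u) (hu : u < 1)
    (hcrit : s * ((u * (1 - p + p * Real.exp (-ξ)) - p * Real.exp (-ξ)) * (u - p)) * Real.exp ξ
      = t * (p * (1 - p)) * (1 - u + u * Real.exp ξ)) :
    legendreDual (rateJ μ ω s t) ξ = ((s * hLog ξ u + t * vLog p ξ u : ℝ) : EReal) :=
  le_antisymm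
    (hω.legendreDual_le hp0 hp1 hξ.le (hLog_nonneg hξ.le (by linarith))
      (vLog_nonneg hp0 hξ.le hpu hu) (logMoment_le hp0 hp1 hξ.le hpu hu) s t)
    (hω.le_legendreDual hp0 hp1 hξ.le hs ht fun _ hε =>
      eventually_le_logMoment hp0 hp1 hξ hpu hu hs ht hcrit hε)

/-- With a single row, the infimum over the parameters is approached as `u → p`. -/
lemma IsBernoulliEnv.legendreDual_right_zero (hp0 : 0 < p) (hp1 : p < 1)
    (hω : IsBernoulliEnv μ p ω) {s ξ : ℝ} (hs : 0 < s) (hξ : 0 < ξ) :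
    legendreDual (rateJ μ ω s 0) ξ = ((s * hLog ξ p : ℝ) : EReal) := by
  refine le_antisymm ?_ (hω.le_legendreDual_boundary hp0 hp1 hξ.le hs.le le_rfl (Or.inr rfl))
  refine EReal.le_of_forall_lt_iff_le.1 fun z hz => ?_
  rw [EReal.coe_lt_coe_iff] at hz
  have hcont : ContinuousAt (fun u => s * hLog ξ u) p :=
    (hasDerivAt_hLog hξ.le hp0.le).continuousAt.const_mul s
  have hev : ∀ᶠ u in 𝓝[>] p, s * hLog ξ u < z ∧ p < u ∧ u < 1 := by
    filter_upwards [nhdsWithin_le_nhds (hcont.eventually (gt_mem_nhds hz)),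
      nhdsWithin_le_nhds (gt_mem_nhds hp1), self_mem_nhdsWithin] with u hu1 hu2 hu3
    exact ⟨hu1, hu3, hu2⟩
  obtain ⟨u, hLu, hpu, hu⟩ := hev.exists
  refine (hω.legendreDual_le hp0 hp1 hξ.le (hLog_nonneg hξ.le (by linarith))
    (vLog_nonneg hp0 hξ.le hpu hu) (logMoment_le hp0 hp1 hξ.le hpu hu) s 0).trans ?_
  rw [zero_mul, add_zero, EReal.coe_le_coe_iff]
  exact hLu.le

end Env

end BernoulliLPP

theorem theorem4p2 {Ω : Type*} [MeasurableSpace Ω] (μ : MeasureTheory.Measure Ω)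
    [MeasureTheory.IsProbabilityMeasure μ] (p : ℝ) (hp0 : 0 < p) (hp1 : p < 1)
    (ω : ℕ × ℕ → Ω → ℕ) (hω : BernoulliLPP.IsBernoulliEnv μ p ω)
    (s t : ℝ) (hs : 0 ≤ s) (ht : 0 ≤ t) :
    -- the rate function is a genuine limit in the interior of its domain
    (0 < s → 0 < t → ∀ r < s,
      Filter.Tendsto (BernoulliLPP.tailExponent μ ω s t r) Filter.atTop
        (nhds (BernoulliLPP.rateJ μ ω s t r))) ∧
    -- at `ξ = 0`, where the closed form reads `0 / 0`
    BernoulliLPP.legendreDual (BernoulliLPP.rateJ μ ω s t) 0 = 0 ∧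
    (∀ ξ : ℝ, 0 < ξ → t < (1 - p) / p * s →
      BernoulliLPP.legendreDual (BernoulliLPP.rateJ μ ω s t) ξ =
        ((s * Real.log
            ((p * (1 - p) * (s + t) * (Real.exp ξ + Real.exp (-ξ) - 2) + 2 * s
                + √(BernoulliLPP.discr p s t ξ)) /
              (2 * s * (1 - p * (1 - Real.exp (-ξ)))))
          + t * Real.log
            ((p * (1 - p) * (s + t) * (Real.exp ξ + Real.exp (-ξ) - 2)
                + √(BernoulliLPP.discr p s t ξ)) * (1 - p * (1 - Real.exp (-ξ))) /
              (p * (1 - p) * (t - s) * (Real.exp ξ + Real.exp (-ξ) - 2)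
                + √(BernoulliLPP.discr p s t ξ))) : ℝ) : EReal)) ∧
    (∀ ξ : ℝ, 0 ≤ ξ → (1 - p) / p * s ≤ t →
      BernoulliLPP.legendreDual (BernoulliLPP.rateJ μ ω s t) ξ = ((s * ξ : ℝ) : EReal)) := by
  open BernoulliLPP in
  have h0 := hω.legendreDual_zero hp0 hp1 hs ht
  refine ⟨fun hs' ht' r hr => ?_, h0, fun ξ hξ hst => ?_, fun ξ hξ hst => ?_⟩
  · have hmem : ((s, t, r) : ℝ × ℝ × ℝ) ∈ rateInterior := ⟨hs', ht', hr⟩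
    have hJ : rateJ μ ω s t r = rateLimit μ ω (s, t, r) := if_pos hmem
    have hlim := hω.tendsto_rateLimit hp0 hp1 hmem
    dsimp only at hlim
    rw [hJ]
    exact hlim
  · have hspos : 0 < s := by
      rcases hs.eq_or_lt with rfl | h
      · rw [mul_zero] at hst; linarith
      · exact h
    have hE : 1 < Real.exp ξ := Real.one_lt_exp_iff.2 hξ
    have hEy : Real.exp ξ * Real.exp (-ξ) = 1 := by rw [← Real.exp_add]; simp
    have hy0 := Real.exp_pos (-ξ)
    have hc : 0 ≤ Real.exp ξ + Real.exp (-ξ) - 2 := by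
      nlinarith [mul_nonneg hy0.le (sq_nonneg (Real.exp ξ - 1))]
    have hq : 0 < 1 - p := by linarith
    rcases ht.eq_or_lt with rfl | htpos
    · rw [hω.legendreDual_right_zero hp0 hp1 hspos hξ, zero_mul, add_zero, hLog]
      have hsq : √(discr p s 0 ξ) = p * (1 - p) * s * (Real.exp ξ + Real.exp (-ξ) - 2) := by
        have hnn : 0 ≤ p * (1 - p) * s * (Real.exp ξ + Real.exp (-ξ) - 2) :=
          mul_nonneg (mul_nonneg (mul_nonneg hp0.le hq.le) hs) hc
        rw [← Real.sqrt_sq hnn, discr]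
        congr 1
        ring
      have hD : 0 < 1 - p * (1 - Real.exp (-ξ)) := by nlinarith
      have harg : (p * (1 - p) * (s + 0) * (Real.exp ξ + Real.exp (-ξ) - 2) + 2 * s
          + p * (1 - p) * s * (Real.exp ξ + Real.exp (-ξ) - 2)) /
            (2 * s * (1 - p * (1 - Real.exp (-ξ)))) = 1 - p + p * Real.exp ξ := by
        rw [div_eq_iff (by positivity)]
        linear_combination (-2 * s * p ^ 2) * hEy
      rw [hsq, harg]
    · have hst' : t * p < (1 - p) * s := by
        rw [div_mul_eq_mul_div, lt_div_iff₀ hp0] at hst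
        exact hst
      have hdisc : 0 ≤ discr p s t ξ := by rw [discr]; positivity
      obtain ⟨u, hpu, hu, hcrit, hX, hY⟩ := exists_critical_param hp0 hp1 hE hEy hspos htpos hst'
        (Real.sqrt_nonneg (discr p s t ξ)) (by rw [Real.sq_sqrt hdisc, discr])
      rw [hω.legendreDual_of_critical hp0 hp1 hspos htpos hξ hpu hu hcrit, hLog, vLog, hX, hY]
  · rcases hξ.eq_or_lt with rfl | hξ
    · simpa using h0
    · exact hω.legendreDual_flat hp0 hp1 hs ht hξ hst
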